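/- **Setting.** Let $\mathcal X\subset\mathbb R^n$ be compact with Lipschitz boundary, let $\mathcal S\subset\mathcal X$ be closed, let $\mathcal G\subset\mathcal S$, and suppose that near each point of $\partial\mathcal S\setminus\overline{\mathcal G}$ the set $\mathcal S$ is, in suitable Cartesian coordinates, the region on and above the graph of a Lipschitz function. Assume that a proper policy exists: there is $\pi:\mathcal X\to\{u\in\mathbb R^n:\|u\|=1\}$ such that from every $x_0\in\mathcal S$ there is a trajectory of $\dot x=\pi(x)$ in $\mathcal X$ that starts at $x_0$ and reaches $\mathcal G$ at a finite time. Let $\mathcal F_c\subset C(\mathcal X;\mathbb R)$ be uniformly equicontinuous, and let $\theta>0$ be such that $\inf_{\mathcal X}c>1/\theta$ and $\sup_{\mathcal X}c<\theta$ for all $c\in\mathcal F_c$. **Eikonal problem.** A function $V\in C(\mathcal X;\mathbb R)$ is called a (state-constrained) viscosity solution of $$\|\nabla V\|=c\ \text{ on }\mathcal S\setminus\mathcal G,\qquad V=c\ \text{ on }\mathcal G,$$ if $V=c$ on $\mathcal G$ and, for every $v\in C^1(\mathbb R^n)$: (a) $\|\nabla v(x)\|\le c(x)$ whenever $x$ is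 in $\mathcal S\setminus\mathcal G$, is an interior point of $\mathcal S$, and is a local maximum point of $V-v$ on $\mathcal S$; (b) $\|\nabla v(x)\|\ge c(x)$ whenever $x\in\mathcal S\setminus\mathcal G$ is a local minimum point of $V-v$ on $\mathcal S$. Let $\Psi:\mathcal F_c\to C(\mathcal X;\mathbb R)$ map each $c\in\mathcal F_c$ to a viscosity solution $\Psi(c)$ of this problem. **Neural operators.** Fix an activation function $\sigma\in C^\infty(\mathbb R)$ that is not affine. Neural networks are feed-forward networks with finitely many hidden layers, activation $\sigma$ and an affine output layer. A nonlocal neural operator is a map $\hat\Psi=\mathcal Q\circ\mathcal L_L\circ\dots\circ\mathcal L_1\circ\mathcal R$ on $C(\mathcal X;\mathbb R)$ with $L\ge1$, where, for some channel dimension $d$, $$(\mathcal R c)(x)=R(c(x),x),\qquad (\mathcal L_l v)(x)=\sigma\Big(W_lv(x)+b_l+\int_{\mathcal X}K_l(x,y)\,v(y)\,dy\Big),\qquad (\mathcal Qs)(x)=Q(s(x),x),$$ with neural networks $R:\mathbb R\times\mathbb R^n\to\mathbb R^d$, $K_l:\mathbb R^n\times\mathbb R^n\to\mathbb R^{d\times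 d}$ and $Q:\mathbb R^d\times\mathbb R^n\to\mathbb R$, with $W_l\in\mathbb R^{d\times d}$ and $b_l\in\mathbb R^d$, and with $\sigma$ acting componentwise. **Theorem.** For every $\varepsilon>0$ there is a nonlocal neural operator $\hat\Psi$ with $$\sup_{c\in\mathcal F_c}\ \sup_{x\in\mathcal S}\ \big|\Psi(c)(x)-\hat\Psi(c)(x)\big|\le\varepsilon .$$ -/

import Mathlib

open MeasureTheory TopologicalSpace
open scoped ContDiff NNReal

/-! ### Geometry and the closed-loop system -/

/-- Near `p`, the set `K` is the (closed) region above the graph of a Lipschitz function, in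
the direction of a unit vector `e`; `x - ⟪e, x⟫ e` is the orthogonal projection of `x` to the
hyperplane `e^⊥`.  A compact set has Lipschitz boundary when this holds at all points of its
frontier. -/
def HasLipschitzBoundaryAt {n : ℕ} (K : Set (EuclideanSpace ℝ (Fin n)))
    (p : EuclideanSpace ℝ (Fin n)) : Prop :=
  ∃ e : EuclideanSpace ℝ (Fin n), ‖e‖ = 1 ∧ ∃ r : ℝ, 0 < r ∧
    ∃ (L : ℝ≥0) (φ : EuclideanSpace ℝ (Fin n) → ℝ), LipschitzWith L φ ∧
      ∀ x ∈ Metric.ball p r, (x ∈ K ↔ φ (x - inner ℝ e x • e) ≤ inner ℝ e x)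

/-- Existence of a proper policy for the fully actuated system `x' = u`, `‖u‖ = 1`, with state
space `X`: there is a feedback law `π` with values in the unit sphere such that from every
initial state in `S` there is a closed-loop (Caratheodory) trajectory `x' = π(x)` that is in `G`
at some finite time `τ`. -/
def HasProperPolicy {n : ℕ} (X : Compacts (EuclideanSpace ℝ (Fin n)))
    (S G : Set (EuclideanSpace ℝ (Fin n))) : Prop :=
  ∃ π : X → Metric.sphere (0 : EuclideanSpace ℝ (Fin n)) 1,
    ∀ x₀ ∈ S, ∃ (τ : ℝ) (γ : ℝ → X), 0 ≤ τ ∧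
      IntervalIntegrable (fun s => (π (γ s) : EuclideanSpace ℝ (Fin n))) volume 0 τ ∧
      (∀ t ∈ Set.Icc 0 τ, (γ t : EuclideanSpace ℝ (Fin n)) =
        x₀ + ∫ s in (0 : ℝ)..t, (π (γ s) : EuclideanSpace ℝ (Fin n))) ∧
      (γ τ : EuclideanSpace ℝ (Fin n)) ∈ G

/-! ### Viscosity solutions of the Eikonal problem -/

/-- `V` is a (state-constrained) viscosity solution of `‖∇V‖ = c` on `S \ G`, `V = c` on `G`:
the subsolution test is made at the points of `S \ G` interior to `S`, the supersolution test at
all points of `S \ G`, with extrema relative to `S`.  This is the notion belonging to the control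
problem in which trajectories have to stay in `S`.  (`V` is continuous on a compact set, hence
bounded and uniformly continuous.) -/
structure IsViscositySolution {n : ℕ} {X : Compacts (EuclideanSpace ℝ (Fin n))}
    (S G : Set (EuclideanSpace ℝ (Fin n))) (c V : C(X, ℝ)) : Prop where
  boundary : ∀ x : X, (x : EuclideanSpace ℝ (Fin n)) ∈ G → V x = c x
  subsolution : ∀ v : EuclideanSpace ℝ (Fin n) → ℝ, ContDiff ℝ 1 v →
    ∀ x : X, (x : EuclideanSpace ℝ (Fin n)) ∈ interior S \ G →
      IsLocalMaxOn (fun y : X => V y - v y) {y : X | (y : EuclideanSpace ℝ (Fin n)) ∈ S} x →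
      ‖gradient v (x : EuclideanSpace ℝ (Fin n))‖ - c x ≤ 0
  supersolution : ∀ v : EuclideanSpace ℝ (Fin n) → ℝ, ContDiff ℝ 1 v →
    ∀ x : X, (x : EuclideanSpace ℝ (Fin n)) ∈ S \ G →
      IsLocalMinOn (fun y : X => V y - v y) {y : X | (y : EuclideanSpace ℝ (Fin n)) ∈ S} x →
      0 ≤ ‖gradient v (x : EuclideanSpace ℝ (Fin n))‖ - c x

/-! ### Neural networks and nonlocal neural operators -/

/-- A (finite-dimensional) feed-forward neural network with `m` inputs and `k` outputs: any number
of hidden layers of any width, and an affine output layer. -/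
inductive NeuralNet : ℕ → ℕ → Type
  | output {m k : ℕ} (W : Matrix (Fin k) (Fin m) ℝ) (b : Fin k → ℝ) : NeuralNet m k
  | layer {m h k : ℕ} (W : Matrix (Fin h) (Fin m) ℝ) (b : Fin h → ℝ) (rest : NeuralNet h k) :
      NeuralNet m k

/-- The function computed by a network whose hidden layers use the activation `σ`. -/
def NeuralNet.eval (σ : C(ℝ, ℝ)) : {m k : ℕ} → NeuralNet m k → C(Fin m → ℝ, Fin k → ℝ)
  | _, _, .output W b => ⟨fun x => W.mulVec x + b, by fun_prop⟩
  | _, _, .layer W b rest =>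
      (rest.eval σ).comp ⟨fun x i => σ ((W.mulVec x + b) i), by fun_prop⟩

/-- Parameters of a hidden layer with `d` channels over a domain in `ℝⁿ`: weights, biases, and
a kernel network `ℝⁿ × ℝⁿ → ℝ^{d × d}`. -/
structure HiddenLayer (n d : ℕ) where
  W : Matrix (Fin d) (Fin d) ℝ
  b : Fin d → ℝ
  kernel : NeuralNet (n + n) (d * d)

/-- The matrix `K(x, y)` of the kernel network. -/
def HiddenLayer.kernelMatrix {n d : ℕ} (l : HiddenLayer n d) (σ : C(ℝ, ℝ))
    (x y : EuclideanSpace ℝ (Fin n)) : Matrix (Fin d) (Fin d) ℝ :=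
  Matrix.of fun i j =>
    l.kernel.eval σ (Fin.append (fun a => x a) (fun a => y a)) (finProdFinEquiv (i, j))

lemma continuous_finAppend {T : Type*} [TopologicalSpace T] {m n : ℕ}
    {f : T → Fin m → ℝ} {g : T → Fin n → ℝ} (hf : Continuous f) (hg : Continuous g) :
    Continuous fun t => Fin.append (f t) (g t) := by
  refine continuous_pi fun i => ?_
  refine Fin.addCases (fun j => ?_) (fun j => ?_) i
  · simpa [Function.comp_def] using (continuous_apply j).comp hf
  · simpa [Function.comp_def] using (continuous_apply j).comp hg

lemma HiddenLayer.continuous_kernelMatrix {n d : ℕ} (l : HiddenLayer n d) (σ : C(ℝ, ℝ)) :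
    Continuous fun p : EuclideanSpace ℝ (Fin n) × EuclideanSpace ℝ (Fin n) =>
      l.kernelMatrix σ p.1 p.2 := by
  refine continuous_matrix fun i j => ?_
  exact (continuous_apply (finProdFinEquiv (i, j))).comp
    ((l.kernel.eval σ).continuous.comp
      (continuous_finAppend (f := fun p : EuclideanSpace ℝ (Fin n) × EuclideanSpace ℝ (Fin n) =>
        fun a => p.1 a) (g := fun p => fun a => p.2 a) (by fun_prop) (by fun_prop)))

/-- The nonlocal term `∫_X K(x, y) v(y) dy` (Lebesgue measure on `X`). -/
noncomputable def HiddenLayer.nonlocal {n d : ℕ} (l : HiddenLayer n d) (σ : C(ℝ, ℝ))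
    {X : Compacts (EuclideanSpace ℝ (Fin n))} (v : C(X, Fin d → ℝ)) (x : X) : Fin d → ℝ :=
  ∫ y : X, (l.kernelMatrix σ x y).mulVec (v y)
    ∂(Measure.comap Subtype.val (volume : Measure (EuclideanSpace ℝ (Fin n))))

lemma HiddenLayer.continuous_nonlocal {n d : ℕ} (l : HiddenLayer n d) (σ : C(ℝ, ℝ))
    {X : Compacts (EuclideanSpace ℝ (Fin n))} (v : C(X, Fin d → ℝ)) :
    Continuous (l.nonlocal σ v) := by
  have hfin : IsFiniteMeasure
      (Measure.comap (Subtype.val : X → EuclideanSpace ℝ (Fin n)) volume) := by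
    refine ⟨?_⟩
    have hm : MeasurableEmbedding (Subtype.val : X → EuclideanSpace ℝ (Fin n)) :=
      MeasurableEmbedding.subtype_coe X.isCompact.isClosed.measurableSet
    rw [hm.comap_apply]
    refine lt_of_le_of_lt (measure_mono ?_) X.isCompact.measure_lt_top
    rintro _ ⟨y, -, rfl⟩
    exact y.2
  have hc : Continuous (Function.uncurry fun x y : X =>
      (l.kernelMatrix σ x y).mulVec (v y)) := by
    refine Continuous.matrix_mulVec ?_ (by fun_prop)
    exact (l.continuous_kernelMatrix σ).comp
      (f := fun p : X × X => ((p.1 : EuclideanSpace ℝ (Fin n)), (p.2 : EuclideanSpace ℝ (Fin n))))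
      (by fun_prop)
  have h := continuous_parametric_integral_of_continuous
    (μ := Measure.comap (Subtype.val : X → EuclideanSpace ℝ (Fin n)) volume)
    hc (s := Set.univ) isCompact_univ
  simp only [Measure.restrict_univ] at h
  exact h

/-- The hidden layer `v ↦ σ(W v(x) + b + ∫_X K(x, y) v(y) dy)`. -/
noncomputable def HiddenLayer.apply {n d : ℕ} (l : HiddenLayer n d) (σ : C(ℝ, ℝ))
    {X : Compacts (EuclideanSpace ℝ (Fin n))} (v : C(X, Fin d → ℝ)) : C(X, Fin d → ℝ) where
  toFun x i := σ ((l.W.mulVec (v x) + l.b + l.nonlocal σ v x) i)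
  continuous_toFun := by
    have := l.continuous_nonlocal σ v
    fun_prop

/-- Parameters of a nonlocal neural operator over a domain in `ℝⁿ`: a channel dimension `d`, a
lifting network `ℝ × ℝⁿ → ℝ^d`, one or more hidden layers, and a projection network
`ℝ^d × ℝⁿ → ℝ`. -/
structure NeuralOperator (n : ℕ) where
  d : ℕ
  lift : NeuralNet (1 + n) d
  hidden : List (HiddenLayer n d)
  hidden_ne_nil : hidden ≠ []
  proj : NeuralNet (d + n) 1

/-- The lifting layer `c ↦ R(c(x), x)`. -/
def NeuralOperator.liftLayer {n : ℕ} (N : NeuralOperator n) (σ : C(ℝ, ℝ))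
    {X : Compacts (EuclideanSpace ℝ (Fin n))} (c : C(X, ℝ)) : C(X, Fin N.d → ℝ) where
  toFun x := N.lift.eval σ
    (Fin.append (fun _ => c x) (fun a => (x : EuclideanSpace ℝ (Fin n)) a))
  continuous_toFun :=
    (N.lift.eval σ).continuous.comp (continuous_finAppend (by fun_prop) (by fun_prop))

/-- The projection layer `s ↦ Q(s(x), x)`. -/
def NeuralOperator.projLayer {n : ℕ} (N : NeuralOperator n) (σ : C(ℝ, ℝ))
    {X : Compacts (EuclideanSpace ℝ (Fin n))} (s : C(X, Fin N.d → ℝ)) : C(X, ℝ) where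
  toFun x := N.proj.eval σ
    (Fin.append (s x) (fun a => (x : EuclideanSpace ℝ (Fin n)) a)) 0
  continuous_toFun :=
    (continuous_apply (0 : Fin 1)).comp
      ((N.proj.eval σ).continuous.comp (continuous_finAppend (by fun_prop) (by fun_prop)))

/-- The operator `Q ∘ L_L ∘ ⋯ ∘ L_1 ∘ R : C(X) → C(X)` with activation `σ`. -/
noncomputable def NeuralOperator.eval {n : ℕ} (N : NeuralOperator n) (σ : C(ℝ, ℝ))
    {X : Compacts (EuclideanSpace ℝ (Fin n))} (c : C(X, ℝ)) : C(X, ℝ) :=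
  N.projLayer σ (N.hidden.foldl (fun v l => l.apply σ v) (N.liftLayer σ c))

/-! The solution operator is uniformly continuous on a totally bounded family of costs, and neural
operators are dense in the continuous functions of `(c, x)`.

Continuity comes from a comparison principle (`IsViscositySolution.le_mul_of_lt_mul`): if `c' < μ c`
everywhere, then `V' ≤ μ V` on `S`. This is Soner's argument for state constraints. The
supersolution test is available up to the boundary but the subsolution test only in the interior, so
the doubling penalty is shifted by a vector `e` along which a Lipschitz boundary lets points move
inwards. Since the costs lie between `1 / θ` and `θ`, a small uniform change of cost is a
multiplication by a factor close to `1`, which gives a modulus of continuity. A partition of unity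
over a finite net then replaces `Ψ` by a function continuous on all of `C(X) × X`.

Density is Stone–Weierstrass on `C(X) × X`. The algebra consists of the functions of `x` and
finitely many values `σ (b + ∫ φᵢ c)`; it separates points because Lebesgue measure charges every
nonempty open subset of `X`. One hidden layer with zero local weight and an almost diagonal kernel
produces these values, and the lifting, kernel and projection maps are supplied by universal
approximation for finite-dimensional networks.

The latter needs depth: `σ` may be a polynomial, and then networks with one hidden layer span a
finite-dimensional space. Difference quotients of neurons give linear forms and squares, hence
products by polarisation; repeated composition while carrying the data along gives all polynomials.
-/

/-! ### Interior cones -/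

/-- Near `p`, all points of `K` move into the interior of `K` in the directions close to a fixed
vector `e`. -/
def HasInteriorConeAt {E : Type*} [NormedAddCommGroup E] [NormedSpace ℝ E] (K : Set E) (p : E) :
    Prop :=
  ∃ e : E, ∃ r : ℝ, 0 < r ∧ ∀ y ∈ K, ‖y - p‖ < r → ∀ t : ℝ, 0 < t → t < r →
    ∀ w : E, ‖w - e‖ < r → y + t • w ∈ interior K

lemma hasInteriorConeAt_of_mem_interior {E : Type*} [NormedAddCommGroup E] [NormedSpace ℝ E]
    {K : Set E} {p : E} (hp : p ∈ interior K) : HasInteriorConeAt K p := by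
  obtain ⟨ρ, hρ, hball⟩ := Metric.isOpen_iff.1 isOpen_interior p hp
  -- At an interior point no direction is needed: with `e = 0` all displacements in question are
  -- short.
  refine ⟨0, min (ρ / 2) 1, by positivity, fun y _ hy t ht htr w hw => hball ?_⟩
  rw [sub_zero] at hw
  rw [mem_ball_iff_norm]
  have h1 : ‖t • w‖ < ρ / 2 := by
    rw [norm_smul, Real.norm_of_nonneg ht.le]
    have := lt_of_lt_of_le htr (min_le_right _ _)
    have := lt_of_lt_of_le hw (min_le_left _ _)
    nlinarith [norm_nonneg w]
  have h2 := lt_of_lt_of_le hy (min_le_left _ _)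
  calc ‖y + t • w - p‖ = ‖(y - p) + t • w‖ := by congr 1; abel
    _ ≤ ‖y - p‖ + ‖t • w‖ := norm_add_le _ _
    _ < ρ := by linarith

lemma norm_sub_inner_smul_le {E : Type*} [NormedAddCommGroup E] [InnerProductSpace ℝ E]
    {e : E} (he : ‖e‖ = 1) (w : E) : ‖w - inner ℝ e w • e‖ ≤ ‖w‖ := by
  rw [← sq_le_sq₀ (norm_nonneg _) (norm_nonneg _), norm_sub_sq_real, inner_smul_right, norm_smul,
    he, real_inner_comm w e, Real.norm_eq_abs, mul_one, sq_abs]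
  nlinarith [sq_nonneg (inner ℝ e w : ℝ)]

/-- A displacement `t • w` with `w` near the axis `e` gains height at least `t (1 - ρ)`, while the
graph below rises by at most `L t ρ`. The condition `(1 + L) ρ < 1` makes the gain strictly larger.
-/
lemma HasLipschitzBoundaryAt.hasInteriorConeAt {n : ℕ} {K : Set (EuclideanSpace ℝ (Fin n))}
    {p : EuclideanSpace ℝ (Fin n)} (h : HasLipschitzBoundaryAt K p) : HasInteriorConeAt K p := by
  obtain ⟨e, he, r, hr, L, φ, hφ, hK⟩ := h
  obtain ⟨ρ, hρ0, hρ1, hρr, hρL⟩ : ∃ ρ : ℝ, 0 < ρ ∧ ρ ≤ 1 ∧ ρ ≤ r / 3 ∧ (1 + L) * ρ < 1 := by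
    refine ⟨min (min 1 (r / 3)) (1 / (2 * (1 + L))), by positivity,
      (min_le_left _ _).trans (min_le_left _ _), (min_le_left _ _).trans (min_le_right _ _), ?_⟩
    have hL : (0 : ℝ) < 1 + L := by positivity
    calc (1 + L : ℝ) * min (min 1 (r / 3)) (1 / (2 * (1 + L)))
        ≤ (1 + L) * (1 / (2 * (1 + L))) := by gcongr; exact min_le_right _ _
      _ = 1 / 2 := by field_simp
      _ < 1 := by norm_num
  refine ⟨e, ρ, hρ0, fun y hy hyp t ht htρ w hw => ?_⟩
  have hwe : ‖w‖ ≤ 1 + ρ := by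
    calc ‖w‖ = ‖e + (w - e)‖ := by congr 1; abel
      _ ≤ ‖e‖ + ‖w - e‖ := norm_add_le _ _
      _ ≤ 1 + ρ := by rw [he]; linarith
  have htw : ‖t • w‖ < 2 * ρ := by
    rw [norm_smul, Real.norm_of_nonneg ht.le]
    nlinarith [norm_nonneg w]
  have hmem : y + t • w ∈ Metric.ball p r := by
    rw [mem_ball_iff_norm]
    calc ‖y + t • w - p‖ = ‖(y - p) + t • w‖ := by congr 1; abel
      _ ≤ ‖y - p‖ + ‖t • w‖ := norm_add_le _ _
      _ < r := by linarith
  have hyK := (hK y (by rw [mem_ball_iff_norm]; linarith)).1 hy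
  have hcont : Continuous φ := hφ.continuous
  have hopen : IsOpen ({x | φ (x - inner ℝ e x • e) < inner ℝ e x} ∩ Metric.ball p r) :=
    (isOpen_lt (by fun_prop) (by fun_prop)).inter Metric.isOpen_ball
  refine interior_maximal (fun x hx => (hK x hx.2).2 (le_of_lt hx.1)) hopen ⟨?_, hmem⟩
  have hin : (inner ℝ e w : ℝ) ≥ 1 - ρ := by
    have h1 : (inner ℝ e w : ℝ) = 1 + inner ℝ e (w - e) := by
      rw [inner_sub_right, real_inner_self_eq_norm_sq, he]; ring
    have h2 := abs_real_inner_le_norm e (w - e)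
    rw [he, one_mul] at h2
    have := neg_abs_le (inner ℝ e (w - e) : ℝ)
    linarith
  have hproj : ‖w - inner ℝ e w • e‖ ≤ ρ := by
    have h1 : w - inner ℝ e w • e = (w - e) - inner ℝ e (w - e) • e := by
      rw [inner_sub_right, real_inner_self_eq_norm_sq, he]; module
    rw [h1]
    exact (norm_sub_inner_smul_le he _).trans hw.le
  have hlip := hφ.dist_le_mul (y + t • w - inner ℝ e (y + t • w) • e) (y - inner ℝ e y • e)
  have hdiff : (y + t • w - inner ℝ e (y + t • w) • e) - (y - inner ℝ e y • e)
      = t • (w - inner ℝ e w • e) := by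
    rw [inner_add_right, inner_smul_right]; module
  rw [dist_eq_norm, dist_eq_norm, hdiff, norm_smul, Real.norm_of_nonneg ht.le,
    Real.norm_eq_abs] at hlip
  have h3 := (abs_le.1 hlip).2
  have h4 : (L : ℝ) * (t * ‖w - inner ℝ e w • e‖) ≤ L * (t * ρ) := by gcongr
  show φ _ < inner ℝ e (y + t • w)
  rw [inner_add_right, inner_smul_right] at *
  nlinarith [mul_le_mul_of_nonneg_left hin ht.le, mul_lt_mul_of_pos_left hρL ht]

lemma hasInteriorConeAt_of_isClosed {n : ℕ} {K : Set (EuclideanSpace ℝ (Fin n))}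
    {p : EuclideanSpace ℝ (Fin n)} (hK : IsClosed K)
    (h : p ∈ frontier K → HasLipschitzBoundaryAt K p) (hp : p ∈ K) : HasInteriorConeAt K p := by
  by_cases hi : p ∈ interior K
  · exact hasInteriorConeAt_of_mem_interior hi
  · exact (h ⟨hK.closure_eq.symm ▸ hp, hi⟩).hasInteriorConeAt

/-! ### Comparison of viscosity solutions -/

/-- One family of quadratics covers both test functions of the comparison proof: `α = 1`, `β = 0`
for the subsolution and `α = β = -μ⁻¹` for the supersolution. -/
lemma gradient_norm_sq_add_norm_sq {E : Type*} [NormedAddCommGroup E] [InnerProductSpace ℝ E]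
    [CompleteSpace E] (α a β : ℝ) (b p z : E) :
    gradient (fun z => α * ‖a • z + b‖ ^ 2 + β * ‖z - p‖ ^ 2) z
      = (2 * α * a) • (a • z + b) + (2 * β) • (z - p) := by
  refine HasGradientAt.gradient ?_
  rw [hasGradientAt_iff_hasFDerivAt]
  have h1 : HasFDerivAt (fun z : E => a • z + b) (a • ContinuousLinearMap.id ℝ E) z :=
    ((hasFDerivAt_id z).const_smul a).add_const b
  have h2 : HasFDerivAt (fun z : E => z - p) (ContinuousLinearMap.id ℝ E) z :=
    (hasFDerivAt_id z).sub_const p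
  have h := (h1.norm_sq.const_mul α).add (h2.norm_sq.const_mul β)
  refine h.congr_fderiv ?_
  ext u
  simp only [InnerProductSpace.toDual_apply_apply]
  simp [inner_add_left, inner_smul_left, inner_sub_left]
  ring

lemma contDiff_norm_sq_add_norm_sq {E : Type*} [NormedAddCommGroup E] [InnerProductSpace ℝ E]
    (α a β : ℝ) (b p : E) :
    ContDiff ℝ 1 fun z : E => α * ‖a • z + b‖ ^ 2 + β * ‖z - p‖ ^ 2 := by
  have h1 : ContDiff ℝ 1 fun z : E => a • z + b := by fun_prop
  have h2 : ContDiff ℝ 1 fun z : E => z - p := by fun_prop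
  exact (contDiff_const.mul (h1.norm_sq ℝ)).add (contDiff_const.mul (h2.norm_sq ℝ))

/-- Doubling of variables with a shift into the interior: if `u - w` is maximal at a point with an
interior cone, then the penalised function of two variables has maximum points close to the
diagonal point, and their difference is almost in the direction of the cone. -/
lemma exists_isMaxOn_doubling {E : Type*} [NormedAddCommGroup E] [NormedSpace ℝ E]
    {X : Compacts E} {S : Set E} (hS : IsClosed S) (hSX : S ⊆ X)
    (u w : C(X, ℝ)) (x₀ : X) (hx₀ : (x₀ : E) ∈ S)
    (hmax : ∀ x : X, (x : E) ∈ S → u x - w x ≤ u x₀ - w x₀) {e : E} {r : ℝ} (hr : 0 < r)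
    (he : ∀ t : ℝ, 0 < t → t < r → (x₀ : E) + t • e ∈ S) {ρ : ℝ} (hρ : 0 < ρ) :
    ∃ ε : ℝ, 0 < ε ∧ ε < ρ ∧ ∃ x y : X, (x : E) ∈ S ∧ (y : E) ∈ S ∧
      ‖ε⁻¹ • ((x : E) - y) - e‖ < ρ ∧ ‖(y : E) - x₀‖ < ρ ∧ ‖(x : E) - y‖ < ρ ∧
      ∀ x' y' : X, (x' : E) ∈ S → (y' : E) ∈ S →
        u x' - w y' - ‖ε⁻¹ • ((x' : E) - y') - e‖ ^ 2 - ‖(y' : E) - x₀‖ ^ 2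
          ≤ u x - w y - ‖ε⁻¹ • ((x : E) - y) - e‖ ^ 2 - ‖(y : E) - x₀‖ ^ 2 := by
  have : CompactSpace X := isCompact_iff_compactSpace.1 X.isCompact
  have hu : UniformContinuous u := CompactSpace.uniformContinuous_of_continuous u.continuous
  obtain ⟨δ, hδ, hδu⟩ := Metric.uniformContinuous_iff.1 hu (ρ ^ 2 / 2) (by positivity)
  set B : ℝ := ‖u‖
  have hB : ∀ x, |u x| ≤ B := fun x => u.norm_coe_le_norm x
  have hB0 : 0 ≤ B := norm_nonneg _
  -- The crude bound `4 B` on the penalty gives `‖x - y‖ ≤ ε D`; uniform continuity of `u` then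
  -- improves it to less than `ρ ^ 2`.
  set D : ℝ := 4 * B + 1 + ‖e‖ with hD
  have hD0 : 0 < D := by positivity
  obtain ⟨ε, hε0, hερ, hεr, hεD⟩ : ∃ ε : ℝ, 0 < ε ∧ ε < ρ ∧ ε < r ∧ ε * D < min δ ρ := by
    refine ⟨min (min (ρ / 2) (r / 2)) (min δ ρ / (2 * D)), by positivity, ?_, ?_, ?_⟩
    · exact ((min_le_left _ _).trans (min_le_left _ _)).trans_lt (by linarith)
    · exact ((min_le_left _ _).trans (min_le_right _ _)).trans_lt (by linarith)
    · have hm : 0 < min δ ρ := by positivity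
      calc _ ≤ min δ ρ / (2 * D) * D := by gcongr; exact min_le_right _ _
        _ = min δ ρ / 2 := by field_simp
        _ < min δ ρ := by linarith
  have hT : IsCompact {x : X | (x : E) ∈ S} :=
    (hS.preimage continuous_subtype_val).isCompact
  obtain ⟨⟨x, y⟩, ⟨hx, hy⟩, hxy⟩ := (hT.prod hT).exists_isMaxOn ⟨(x₀, x₀), hx₀, hx₀⟩
    (f := fun q : X × X => u q.1 - w q.2 - ‖ε⁻¹ • ((q.1 : E) - q.2) - e‖ ^ 2
      - ‖(q.2 : E) - x₀‖ ^ 2) (by fun_prop)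
  have hall : ∀ x' y' : X, (x' : E) ∈ S → (y' : E) ∈ S →
        u x' - w y' - ‖ε⁻¹ • ((x' : E) - y') - e‖ ^ 2 - ‖(y' : E) - x₀‖ ^ 2
          ≤ u x - w y - ‖ε⁻¹ • ((x : E) - y) - e‖ ^ 2 - ‖(y : E) - x₀‖ ^ 2 :=
    fun x' y' hx' hy' => hxy (show (x', y') ∈ _ from ⟨hx', hy'⟩)
  -- At the competitor `(x₀ + ε e, x₀)` both penalties vanish. Combined with the maximality of `u -
  -- w` at `x₀`, this bounds the penalty by increments of `u` alone.
  set z : X := ⟨(x₀ : E) + ε • e, hSX (he ε hε0 hεr)⟩ with hz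
  have hzval : (z : E) = (x₀ : E) + ε • e := rfl
  have h1 := hall z x₀ (he ε hε0 hεr) hx₀
  rw [hzval, add_sub_cancel_left, inv_smul_smul₀ hε0.ne', sub_self, sub_self, norm_zero] at h1
  have h2 := hmax y hy
  have hsum : ‖ε⁻¹ • ((x : E) - y) - e‖ ^ 2 + ‖(y : E) - x₀‖ ^ 2
      ≤ |u x - u y| + |u x₀ - u z| := by
    have := le_abs_self (u x - u y)
    have := le_abs_self (u x₀ - u z)
    nlinarith
  have hq : ‖ε⁻¹ • ((x : E) - y) - e‖ ≤ 4 * B + 1 := by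
    have h3 : |u x - u y| ≤ 2 * B := (abs_sub _ _).trans (by linarith [hB x, hB y])
    have h4 : |u x₀ - u z| ≤ 2 * B := (abs_sub _ _).trans (by linarith [hB x₀, hB z])
    by_contra! hcon
    nlinarith [sq_nonneg ‖(y : E) - x₀‖]
  have hxyn : ‖(x : E) - y‖ ≤ ε * D := by
    have h3 : (x : E) - y = ε • ((ε⁻¹ • ((x : E) - y) - e) + e) := by
      rw [sub_add_cancel, smul_inv_smul₀ hε0.ne']
    rw [h3, norm_smul, Real.norm_of_nonneg hε0.le]
    gcongr
    exact (norm_add_le _ _).trans (by rw [hD]; linarith)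
  have h5 : |u x - u y| < ρ ^ 2 / 2 := by
    have := hδu (a := x) (b := y) (by
      rw [Subtype.dist_eq, dist_eq_norm]
      exact (hxyn.trans_lt hεD).trans_le (min_le_left _ _))
    rwa [Real.dist_eq] at this
  have h6 : |u x₀ - u z| < ρ ^ 2 / 2 := by
    have := hδu (a := x₀) (b := z) (by
      rw [Subtype.dist_eq, dist_eq_norm, hzval, sub_add_cancel_left, norm_neg, norm_smul,
        Real.norm_of_nonneg hε0.le]
      refine lt_of_le_of_lt ?_ (hεD.trans_le (min_le_left _ _))
      gcongr
      rw [hD]; linarith)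
    rwa [Real.dist_eq] at this
  refine ⟨ε, hε0, hερ, x, y, hx, hy, ?_, ?_, (hxyn.trans_lt hεD).trans_le (min_le_right _ _),
    hall⟩
  · exact lt_of_pow_lt_pow_left₀ 2 hρ.le (by nlinarith [sq_nonneg ‖(y : E) - x₀‖])
  · exact lt_of_pow_lt_pow_left₀ 2 hρ.le
      (by nlinarith [sq_nonneg ‖ε⁻¹ • ((x : E) - y) - e‖])

/-- `G` need not be closed; continuity extends the boundary condition. This keeps the maximum point
of the comparison proof away from `closure G`, beyond which the boundary of `S` is Lipschitz. -/
lemma IsViscositySolution.eq_of_mem_closure {n : ℕ} {X : Compacts (EuclideanSpace ℝ (Fin n))}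
    {S G : Set (EuclideanSpace ℝ (Fin n))} {c V : C(X, ℝ)} (hV : IsViscositySolution S G c V)
    (hGX : G ⊆ X) {x : X} (hx : (x : EuclideanSpace ℝ (Fin n)) ∈ closure G) : V x = c x := by
  have hcl : x ∈ closure ((↑) ⁻¹' G : Set X) := by
    have himage : ((↑) : X → EuclideanSpace ℝ (Fin n)) '' ((↑) ⁻¹' G) = G := by
      ext y
      exact ⟨fun ⟨z, hz, hzy⟩ => hzy ▸ hz, fun hy => ⟨⟨y, hGX hy⟩, hy, rfl⟩⟩
    rwa [closure_subtype, himage]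
  exact closure_minimal (t := {x : X | V x = c x}) (fun y hy => hV.boundary y hy)
    (isClosed_eq V.continuous c.continuous) hcl

/-- Comparison principle for the state-constrained Eikonal equation, in multiplicative form. -/
lemma IsViscositySolution.le_mul_of_lt_mul {n : ℕ} {X : Compacts (EuclideanSpace ℝ (Fin n))}
    {S G : Set (EuclideanSpace ℝ (Fin n))} (hSX : S ⊆ X) (hGS : G ⊆ S) (hS : IsClosed S)
    (hS_lip : ∀ p ∈ frontier S \ closure G, HasLipschitzBoundaryAt S p)
    {c c' V V' : C(X, ℝ)} (hV : IsViscositySolution S G c V) (hV' : IsViscositySolution S G c' V')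
    {μ : ℝ} (hμ : 0 < μ) (hlt : ∀ x : X, c' x < μ * c x)
    (x : X) (hx : (x : EuclideanSpace ℝ (Fin n)) ∈ S) : V' x ≤ μ * V x := by
  have : CompactSpace X := isCompact_iff_compactSpace.1 X.isCompact
  have hT : IsCompact {x : X | (x : EuclideanSpace ℝ (Fin n)) ∈ S} :=
    (hS.preimage continuous_subtype_val).isCompact
  obtain ⟨x₀, hx₀, hmax⟩ := hT.exists_isMaxOn ⟨x, hx⟩
    (f := fun x : X => V' x - (μ • V) x) (by fun_prop)
  by_contra! hcon
  have hpos : μ * V x₀ < V' x₀ := by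
    have : V' x - (μ • V) x ≤ V' x₀ - (μ • V) x₀ := hmax hx
    simp only [ContinuousMap.smul_apply, smul_eq_mul] at this
    linarith
  have hx₀G : (x₀ : EuclideanSpace ℝ (Fin n)) ∉ closure G := fun h => by
    rw [hV.eq_of_mem_closure (hGS.trans hSX) h, hV'.eq_of_mem_closure (hGS.trans hSX) h] at hpos
    exact lt_asymm hpos (hlt x₀)
  obtain ⟨e, r, hr, hcone⟩ := hasInteriorConeAt_of_isClosed hS (fun h => hS_lip _ ⟨h, hx₀G⟩) hx₀
  obtain ⟨r', hr', hballG⟩ := Metric.isOpen_iff.1 isClosed_closure.isOpen_compl _ hx₀G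
  have hnotG : ∀ y : X, ‖(y : EuclideanSpace ℝ (Fin n)) - x₀‖ < r' →
      (y : EuclideanSpace ℝ (Fin n)) ∉ G := fun y hy hyG =>
    hballG (mem_ball_iff_norm.2 hy) (subset_closure hyG)
  -- The two tests will give `μ c(z) ≤ c'(y) + 2 ρ`. Moving both costs to `x₀` and using `ρ ≤ η`
  -- yields `6 η < 4 η`.
  set η : ℝ := (μ * c x₀ - c' x₀) / 6 with hη
  have hη0 : 0 < η := by have := hlt x₀; rw [hη]; linarith
  obtain ⟨δ₁, hδ₁, hc₁⟩ := Metric.continuous_iff.1 (μ • c).continuous x₀ η hη0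
  obtain ⟨δ₂, hδ₂, hc₂⟩ := Metric.continuous_iff.1 c'.continuous x₀ η hη0
  obtain ⟨ρ, hρ, hρr, hρr', hρ₁, hρ₂, hρη⟩ : ∃ ρ : ℝ, 0 < ρ ∧ ρ ≤ r ∧ 2 * ρ ≤ r' ∧ 2 * ρ ≤ δ₁ ∧
      2 * ρ ≤ δ₂ ∧ ρ ≤ η := by
    have hev : ∀ s : ℝ, 0 < s → ∀ᶠ ρ in nhdsWithin (0 : ℝ) (Set.Ioi 0), ρ ∈ Set.Ioo 0 s :=
      fun s hs => Ioo_mem_nhdsGT hs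
    obtain ⟨ρ, h1, h2, h3, h4, h5⟩ := ((hev r hr).and <| (hev (r' / 2) (half_pos hr')).and <|
      (hev (δ₁ / 2) (half_pos hδ₁)).and <| (hev (δ₂ / 2) (half_pos hδ₂)).and (hev η hη0)).exists
    exact ⟨ρ, h1.1, h1.2.le, by linarith [h2.2], by linarith [h3.2], by linarith [h4.2], h5.2.le⟩
  obtain ⟨ε, hε, hερ, y, z, hy, hz, hq, hzx, hyz, hall⟩ := exists_isMaxOn_doubling hS hSX V' (μ • V)
    x₀ hx₀ (fun x hx => hmax hx) hr
    (fun t ht htr => interior_subset (hcone _ hx₀ (by simpa using hr) t ht htr e (by simpa using hr)))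
    hρ
  have hyx : ‖(y : EuclideanSpace ℝ (Fin n)) - x₀‖ < 2 * ρ := by
    calc _ = ‖((y : EuclideanSpace ℝ (Fin n)) - z) + (z - x₀)‖ := by congr 1; abel
      _ ≤ _ := norm_add_le _ _
      _ < 2 * ρ := by linarith
  -- The shift pays off here: `y` is `z` moved by `ε` times a vector close to `e`, hence interior
  -- even if `z` lies on the boundary.
  have hyint : (y : EuclideanSpace ℝ (Fin n)) ∈ interior S := by
    have := hcone z hz (by linarith) ε hε (by linarith)
      (ε⁻¹ • ((y : EuclideanSpace ℝ (Fin n)) - z)) (by linarith)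
    rwa [smul_inv_smul₀ hε.ne', add_sub_cancel] at this
  set q := ε⁻¹ • ((y : EuclideanSpace ℝ (Fin n)) - z) - e with hqdef
  have hsub : ‖(2 * ε⁻¹) • q‖ ≤ c' y := by
    have h := hV'.subsolution _ (contDiff_norm_sq_add_norm_sq 1 ε⁻¹ 0
      (-(ε⁻¹ • (z : EuclideanSpace ℝ (Fin n))) - e) 0) y ⟨hyint, hnotG y (by linarith)⟩ ?_
    · rw [gradient_norm_sq_add_norm_sq] at h
      have h1 : ε⁻¹ • (y : EuclideanSpace ℝ (Fin n)) + (-(ε⁻¹ • (z : EuclideanSpace ℝ (Fin n))) - e)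
          = q := by rw [hqdef]; module
      rw [h1] at h
      simpa using h
    · refine Filter.eventually_inf_principal.2 (Filter.Eventually.of_forall fun x' hx' => ?_)
      have h := hall x' z hx' hz
      have h1 : ∀ x'' : EuclideanSpace ℝ (Fin n), ε⁻¹ • x'' +
          (-(ε⁻¹ • (z : EuclideanSpace ℝ (Fin n))) - e) = ε⁻¹ • (x'' - z) - e := fun _ => by module
      simp only [h1]
      linarith
  -- Both tests see the same vector `(2 * ε⁻¹) • q`, so its possibly large norm drops out; only the
  -- localising term `‖z - x₀‖ ^ 2` leaves an error.
  have hsup : μ * c z ≤ ‖(2 * ε⁻¹) • q‖ + 2 * ‖(z : EuclideanSpace ℝ (Fin n)) - x₀‖ := by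
    have h := hV.supersolution _ (contDiff_norm_sq_add_norm_sq (-μ⁻¹) (-ε⁻¹) (-μ⁻¹)
      (ε⁻¹ • (y : EuclideanSpace ℝ (Fin n)) - e) x₀) z ⟨hz, hnotG z (by linarith)⟩ ?_
    · rw [gradient_norm_sq_add_norm_sq] at h
      have h1 : -ε⁻¹ • (z : EuclideanSpace ℝ (Fin n)) + (ε⁻¹ • (y : EuclideanSpace ℝ (Fin n)) - e)
          = q := by rw [hqdef]; module
      have h2 : (2 * -μ⁻¹ * -ε⁻¹) • q + (2 * -μ⁻¹) • ((z : EuclideanSpace ℝ (Fin n)) - x₀)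
          = μ⁻¹ • ((2 * ε⁻¹) • q - (2 : ℝ) • ((z : EuclideanSpace ℝ (Fin n)) - x₀)) := by module
      rw [h1, h2, norm_smul, Real.norm_of_nonneg (by positivity)] at h
      have h3 := norm_sub_le ((2 * ε⁻¹) • q) ((2 : ℝ) • ((z : EuclideanSpace ℝ (Fin n)) - x₀))
      rw [norm_smul (2 : ℝ), Real.norm_of_nonneg (by norm_num : (0 : ℝ) ≤ 2)] at h3
      refine le_trans ?_ h3
      rw [sub_nonneg, inv_mul_eq_div, le_div_iff₀ hμ] at h
      linarith
    · refine Filter.eventually_inf_principal.2 (Filter.Eventually.of_forall fun z' hz' => ?_)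
      have h := hall y z' hy hz'
      have h1 : ∀ z'' : EuclideanSpace ℝ (Fin n), -ε⁻¹ • z'' +
          (ε⁻¹ • (y : EuclideanSpace ℝ (Fin n)) - e) = ε⁻¹ • (y - z'') - e := fun _ => by module
      simp only [h1]
      simp only [ContinuousMap.smul_apply, smul_eq_mul, hqdef] at h
      have h2 := mul_le_mul_of_nonneg_left h (inv_pos.2 hμ).le
      have h3 : ∀ v : ℝ, μ⁻¹ * (μ * v) = v := fun v => inv_mul_cancel_left₀ hμ.ne' v
      simp only [mul_sub, h3] at h2
      linarith
  have hdz := hc₁ z (by rw [Subtype.dist_eq, dist_eq_norm]; linarith)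
  have hdy := hc₂ y (by rw [Subtype.dist_eq, dist_eq_norm]; linarith)
  rw [Real.dist_eq, abs_lt] at hdz hdy
  simp only [ContinuousMap.smul_apply, smul_eq_mul] at hdz
  linarith [hdz.1, hdy.2]

/-! ### Universal approximation by deep networks with a smooth activation -/

lemma ContinuousMap.mem_closure_iff_forall_isCompact {α β : Type*} [TopologicalSpace α]
    [PseudoMetricSpace β] {A : Set C(α, β)} {f : C(α, β)} :
    f ∈ closure A ↔ ∀ K : Set α, IsCompact K → ∀ δ : ℝ, 0 < δ →
      ∃ g ∈ A, ∀ x ∈ K, dist (f x) (g x) < δ := by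
  rw [mem_closure_iff_nhds_basis'
    (nhds_basis_uniformity' (Metric.uniformity_basis_dist.compactConvergenceUniformity))]
  constructor
  · intro h K hK δ hδ
    obtain ⟨g, hg, hgA⟩ := h (K, δ) ⟨hK, hδ⟩
    exact ⟨g, hgA, hg⟩
  · rintro h ⟨K, δ⟩ ⟨hK, hδ⟩
    obtain ⟨g, hgA, hg⟩ := h K hK δ hδ
    exact ⟨g, hg, hgA⟩

/-- An affine map is absorbed by the first weights and bias. Composing networks therefore leaves no
unactivated layer in between. -/
lemma NeuralNet.exists_eval_eq_comp_affine (σ : C(ℝ, ℝ)) {a m k : ℕ} (N : NeuralNet m k)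
    (W : Matrix (Fin m) (Fin a) ℝ) (b : Fin m → ℝ) :
    ∃ N' : NeuralNet a k, ∀ x, N'.eval σ x = N.eval σ (W.mulVec x + b) := by
  cases N with
  | output W' b' =>
    refine ⟨.output (W' * W) (W'.mulVec b + b'), fun x => ?_⟩
    simp [NeuralNet.eval, Matrix.mulVec_add, Matrix.mulVec_mulVec, add_assoc]
  | layer W' b' rest =>
    refine ⟨.layer (W' * W) (W'.mulVec b + b') rest, fun x => ?_⟩
    simp [NeuralNet.eval, Matrix.mulVec_add, Matrix.mulVec_mulVec, add_assoc]

lemma NeuralNet.exists_eval_eq_comp (σ : C(ℝ, ℝ)) {a m k : ℕ} (M : NeuralNet a m)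
    (N : NeuralNet m k) : ∃ N' : NeuralNet a k, N'.eval σ = (N.eval σ).comp (M.eval σ) := by
  induction M with
  | output W b =>
    obtain ⟨N', hN'⟩ := N.exists_eval_eq_comp_affine σ W b
    exact ⟨N', ContinuousMap.ext hN'⟩
  | layer W b rest ih =>
    obtain ⟨N', hN'⟩ := ih N
    refine ⟨.layer W b N', ?_⟩
    simp only [NeuralNet.eval, hN', ContinuousMap.comp_assoc]

/-- Maps that are limits of networks, uniformly on compact sets. -/
def NeuralNet.approximable (σ : C(ℝ, ℝ)) (m k : ℕ) : Set C(Fin m → ℝ, Fin k → ℝ) :=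
  closure (Set.range fun N : NeuralNet m k => N.eval σ)

lemma NeuralNet.comp_mem_approximable {σ : C(ℝ, ℝ)} {a m k : ℕ}
    {f : C(Fin a → ℝ, Fin m → ℝ)} {g : C(Fin m → ℝ, Fin k → ℝ)}
    (hf : f ∈ NeuralNet.approximable σ a m) (hg : g ∈ NeuralNet.approximable σ m k) :
    g.comp f ∈ NeuralNet.approximable σ a k := by
  refine map_mem_closure₂ (f := fun f g => ContinuousMap.comp g f)
    (ContinuousMap.continuous_comp') hf hg ?_
  rintro _ ⟨M, rfl⟩ _ ⟨N, rfl⟩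
  obtain ⟨N', hN'⟩ := M.exists_eval_eq_comp σ N
  exact ⟨N', hN'⟩

lemma NeuralNet.linear_mem_approximable (σ : C(ℝ, ℝ)) {m k : ℕ}
    (A : (Fin m → ℝ) →L[ℝ] (Fin k → ℝ)) :
    (A : C(Fin m → ℝ, Fin k → ℝ)) ∈ NeuralNet.approximable σ m k := by
  refine subset_closure ⟨.output (LinearMap.toMatrix' (A : (Fin m → ℝ) →ₗ[ℝ] (Fin k → ℝ))) 0, ?_⟩
  ext x
  simp [NeuralNet.eval, LinearMap.toMatrix'_mulVec]

/-- A single neuron `x ↦ σ(w ⬝ x + b)`. -/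
def neuron (σ : C(ℝ, ℝ)) {m : ℕ} (p : (Fin m → ℝ) × ℝ) : C(Fin m → ℝ, ℝ) where
  toFun x := σ (p.1 ⬝ᵥ x + p.2)

/-- Scalar networks with one hidden layer (and no output bias). -/
def shallow (σ : C(ℝ, ℝ)) (m : ℕ) : Submodule ℝ C(Fin m → ℝ, ℝ) :=
  Submodule.span ℝ (Set.range (neuron σ))

lemma exists_neuralNet_of_forall_mem_shallow {σ : C(ℝ, ℝ)} {m k : ℕ}
    {f : Fin k → C(Fin m → ℝ, ℝ)} (hf : ∀ i, f i ∈ shallow σ m) :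
    ∃ N : NeuralNet m k, N.eval σ = ContinuousMap.pi f := by
  classical
  have h : ∀ i, ∃ a : ((Fin m → ℝ) × ℝ) →₀ ℝ, a.sum (fun p t => t • neuron σ p) = f i :=
    fun i => Finsupp.mem_span_range_iff_exists_finsupp.1 (hf i)
  choose a ha using h
  -- All outputs share one hidden layer, made of every neuron that some component uses.
  set s : Finset ((Fin m → ℝ) × ℝ) := Finset.univ.biUnion fun i => (a i).support
  let e := s.equivFin.symm
  refine ⟨.layer (Matrix.of fun j => (e j).1.1) (fun j => (e j).1.2)
    (.output (Matrix.of fun i j => a i (e j).1) 0), ?_⟩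
  ext x i
  have h1 : f i x = ∑ p ∈ s, a i p * neuron σ p x := by
    rw [← ha i, Finsupp.sum_of_support_subset (s := s) _
      (Finset.subset_biUnion_of_mem (fun i => (a i).support) (Finset.mem_univ i)) _ (by simp)]
    simp [ContinuousMap.sum_apply]
  have h2 : ∑ p ∈ s, a i p * neuron σ p x = ∑ j, a i (e j).1 * neuron σ (e j).1 x := by
    rw [← Finset.sum_coe_sort s, ← e.sum_comp]
  simp only [ContinuousMap.pi_eval, h1, h2]
  simp [NeuralNet.eval, Matrix.mulVec, dotProduct, neuron]

lemma pi_mem_approximable {σ : C(ℝ, ℝ)} {m k : ℕ} {f : Fin k → C(Fin m → ℝ, ℝ)}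
    (hf : ∀ i, f i ∈ (shallow σ m).topologicalClosure) :
    ContinuousMap.pi f ∈ NeuralNet.approximable σ m k := by
  have hcont : Continuous fun f : Fin k → C(Fin m → ℝ, ℝ) => ContinuousMap.pi f :=
    ContinuousMap.continuous_of_continuous_uncurry _ (by
      refine continuous_pi fun i => ?_
      exact continuous_eval.comp (f := fun p : (Fin k → C(Fin m → ℝ, ℝ)) × (Fin m → ℝ) =>
        (p.1 i, p.2)) (by fun_prop))
  have hmem : f ∈ closure (Set.univ.pi fun _ => (shallow σ m : Set C(Fin m → ℝ, ℝ))) := by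
    rw [closure_pi_set]
    exact fun i _ => hf i
  refine map_mem_closure hcont hmem fun g hg => ?_
  obtain ⟨N, hN⟩ := exists_neuralNet_of_forall_mem_shallow (f := g) fun i => hg i trivial
  exact ⟨N, hN⟩

lemma exists_deriv_deriv_ne_zero {σ : ℝ → ℝ} (hσ : ContDiff ℝ 2 σ)
    (h : ¬ ∃ a b : ℝ, ∀ t, σ t = a * t + b) : ∃ t, deriv (deriv σ) t ≠ 0 := by
  by_contra! hcon
  have h1 : Differentiable ℝ (deriv σ) :=
    (contDiff_succ_iff_deriv.1 (show ContDiff ℝ (1 + 1) σ from hσ)).2.2.differentiable one_ne_zero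
  have h2 : ∀ t, deriv σ t = deriv σ 0 := fun t => is_const_of_deriv_eq_zero h1 hcon t 0
  have h3 : Differentiable ℝ σ := hσ.differentiable two_ne_zero
  refine h ⟨deriv σ 0, σ 0, fun t => ?_⟩
  have h4 : ∀ t, deriv (fun t => σ t - deriv σ 0 * t) t = 0 := fun t => by
    rw [deriv_fun_sub (h3 t) (by fun_prop), h2 t, deriv_const_mul _ (by fun_prop)]
    simp
  have : σ t - deriv σ 0 * t = σ 0 - deriv σ 0 * 0 :=
    is_const_of_deriv_eq_zero (h3.fun_sub (by fun_prop)) h4 t 0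
  linarith

lemma exists_deriv_ne_zero {σ : ℝ → ℝ} (hσ : Differentiable ℝ σ)
    (h : ¬ ∃ a b : ℝ, ∀ t, σ t = a * t + b) : ∃ t, deriv σ t ≠ 0 := by
  by_contra! hcon
  exact h ⟨0, σ 0, fun t => by simpa using is_const_of_deriv_eq_zero hσ hcon t 0⟩

section shallow_closure

variable {σ : C(ℝ, ℝ)} {m : ℕ}

lemma neuron_mem_shallow (w : Fin m → ℝ) (b : ℝ) : neuron σ (w, b) ∈ shallow σ m :=
  Submodule.subset_span ⟨_, rfl⟩

lemma one_mem_closure_shallow (h : ¬ ∃ a b : ℝ, ∀ t, σ t = a * t + b) :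
    (1 : C(Fin m → ℝ, ℝ)) ∈ (shallow σ m).topologicalClosure := by
  obtain ⟨b, hb⟩ : ∃ b, σ b ≠ 0 := by
    by_contra! hcon
    exact h ⟨0, 0, fun t => by simp [hcon t]⟩
  refine Submodule.le_topologicalClosure _ ?_
  have := (shallow σ m).smul_mem (σ b)⁻¹ (neuron_mem_shallow (0 : Fin m → ℝ) b)
  convert this using 1
  ext x
  simp [neuron, hb]

/-- Limits of rescaled elements: if `g h ∈ M` for `h ≠ 0` depends continuously on `h`, then
`g 0 ∈ M`. -/
lemma Submodule.mem_topologicalClosure_of_curve {V : Type*} [TopologicalSpace V] [AddCommGroup V]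
    [IsTopologicalAddGroup V] [Module ℝ V] [ContinuousConstSMul ℝ V] {M : Submodule ℝ V}
    {g : ℝ → V} (hg : Continuous g) (h : ∀ t, t ≠ 0 → g t ∈ M.topologicalClosure) :
    g 0 ∈ M.topologicalClosure := by
  refine M.isClosed_topologicalClosure.mem_of_tendsto
    ((hg.tendsto 0).mono_left (nhdsWithin_le_nhds (s := {0}ᶜ))) ?_
  filter_upwards [self_mem_nhdsWithin] with t ht using h t ht

/-- The quotients `(σ (b + t w ⬝ᵥ x) - σ b) / t` tend to `σ' b * (w ⬝ᵥ x)`. Writing them with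
`dslope` makes the curve continuous at `t = 0`, locally uniformly in `x`. -/
lemma linear_mem_closure_shallow (hσ : Differentiable ℝ σ)
    (h : ¬ ∃ a b : ℝ, ∀ t, σ t = a * t + b) (w : Fin m → ℝ) :
    (⟨fun x => w ⬝ᵥ x, by fun_prop⟩ : C(Fin m → ℝ, ℝ)) ∈ (shallow σ m).topologicalClosure := by
  obtain ⟨b, hb⟩ := exists_deriv_ne_zero hσ h
  have hd : Continuous (dslope σ b) := continuous_iff_continuousAt.2 fun t => by
    rcases eq_or_ne t b with rfl | htb
    · exact continuousAt_dslope_same.2 (hσ t)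
    · exact (continuousAt_dslope_of_ne htb).2 σ.continuous.continuousAt
  let g : ℝ → C(Fin m → ℝ, ℝ) := fun t =>
    ⟨fun x => (w ⬝ᵥ x) * dslope σ b (b + t * (w ⬝ᵥ x)), by fun_prop⟩
  have hg : Continuous g := ContinuousMap.continuous_of_continuous_uncurry _ (by
    simp only [g, Function.uncurry_def, ContinuousMap.coe_mk]; fun_prop)
  have h0 := Submodule.mem_topologicalClosure_of_curve (M := shallow σ m) hg fun t ht => by
    refine Submodule.le_topologicalClosure _ ?_
    have := (shallow σ m).smul_mem t⁻¹ ((shallow σ m).sub_mem (neuron_mem_shallow (t • w) b)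
      (neuron_mem_shallow (0 : Fin m → ℝ) b))
    convert this using 1
    ext x
    have h1 := sub_smul_dslope σ b (b + t * (w ⬝ᵥ x))
    simp only [add_sub_cancel_left, smul_eq_mul] at h1
    simp only [g, neuron, ContinuousMap.coe_mk, ContinuousMap.smul_apply, ContinuousMap.sub_apply,
      smul_dotProduct, zero_dotProduct, zero_add, smul_eq_mul]
    rw [add_comm (t * _), ← h1]
    field_simp
  have := (shallow σ m).topologicalClosure.smul_mem (deriv σ b)⁻¹ h0
  convert this using 1
  ext x
  simp [g, dslope_same]
  field_simp

lemma continuous_taylor_two_quotient {σ : ℝ → ℝ} (hσ : ContDiff ℝ 2 σ) (b : ℝ) :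
    Continuous fun t => if t = 0 then deriv (deriv σ) b / 2 else
      (σ (b + t) - σ b - t * deriv σ b) / t ^ 2 := by
  have hc : Continuous σ := hσ.continuous
  refine continuous_iff_continuousAt.2 fun t => ?_
  rcases eq_or_ne t 0 with rfl | ht
  · rw [continuousAt_iff_punctured_nhds, if_pos rfl]
    have h := Real.taylor_tendsto (x₀ := b) (n := 2) convex_univ (Set.mem_univ b)
      (f := σ) hσ.contDiffOn
    rw [nhdsWithin_univ] at h
    have h1 : Filter.Tendsto (fun t : ℝ => b + t) (nhdsWithin 0 {0}ᶜ) (nhds b) := by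
      have : Filter.Tendsto (fun t : ℝ => b + t) (nhds 0) (nhds (b + 0)) :=
        (continuous_const.add continuous_id).tendsto 0
      rw [add_zero] at this
      exact this.mono_left nhdsWithin_le_nhds
    have h2 := (h.comp h1).add_const (deriv (deriv σ) b / 2)
    rw [zero_add] at h2
    refine h2.congr' ?_
    filter_upwards [self_mem_nhdsWithin] with t ht
    have ht : t ≠ 0 := ht
    simp only [Function.comp_apply, if_neg ht, taylorWithinEval_succ, taylor_within_zero_eval,
      iteratedDerivWithin_univ, iteratedDeriv_succ, iteratedDeriv_zero]
    simp
    field_simp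
    ring
  · have : ContinuousAt (fun t => (σ (b + t) - σ b - t * deriv σ b) / t ^ 2) t :=
      ContinuousAt.div (by fun_prop) (by fun_prop) (by positivity)
    refine this.congr ?_
    filter_upwards [isOpen_ne.mem_nhds ht] with s hs
    rw [if_neg hs]

/-- Second-order version of the same limit, at a point where `σ''` does not vanish. The first-order
Taylor term is subtracted inside the closure, where linear forms already lie. -/
lemma sq_mem_closure_shallow (hσ : ContDiff ℝ 2 σ)
    (h : ¬ ∃ a b : ℝ, ∀ t, σ t = a * t + b) (w : Fin m → ℝ) :
    (⟨fun x => (w ⬝ᵥ x) ^ 2, by fun_prop⟩ : C(Fin m → ℝ, ℝ)) ∈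
      (shallow σ m).topologicalClosure := by
  obtain ⟨b, hb⟩ := exists_deriv_deriv_ne_zero hσ h
  have hq := continuous_taylor_two_quotient hσ b
  set q := fun t => if t = 0 then deriv (deriv σ) b / 2 else
      (σ (b + t) - σ b - t * deriv σ b) / t ^ 2 with hqdef
  let g : ℝ → C(Fin m → ℝ, ℝ) := fun t => ⟨fun x => (w ⬝ᵥ x) ^ 2 * q (t * (w ⬝ᵥ x)), by fun_prop⟩
  have hg : Continuous g := ContinuousMap.continuous_of_continuous_uncurry _ (by
    simp only [g, Function.uncurry_def, ContinuousMap.coe_mk]; fun_prop)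
  have h0 := Submodule.mem_topologicalClosure_of_curve (M := shallow σ m) hg fun t ht => by
    have := (shallow σ m).topologicalClosure.smul_mem (t ^ 2)⁻¹
      ((shallow σ m).topologicalClosure.sub_mem (Submodule.le_topologicalClosure _
        ((shallow σ m).sub_mem (neuron_mem_shallow (t • w) b)
          (neuron_mem_shallow (0 : Fin m → ℝ) b)))
      ((shallow σ m).topologicalClosure.smul_mem (deriv σ b)
        (linear_mem_closure_shallow (hσ.differentiable two_ne_zero) h (t • w))))
    convert this using 1
    ext x
    simp only [g, neuron, ContinuousMap.coe_mk, ContinuousMap.smul_apply, ContinuousMap.sub_apply,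
      smul_dotProduct, zero_dotProduct, zero_add, smul_eq_mul]
    rw [add_comm (t * _)]
    by_cases hx : w ⬝ᵥ x = 0
    · simp [hx]
    · simp only [hqdef, if_neg (mul_ne_zero ht hx)]
      field_simp
  have := (shallow σ m).topologicalClosure.smul_mem (deriv (deriv σ) b / 2)⁻¹ h0
  convert this using 1
  ext x
  simp [g, hqdef]
  field_simp

lemma coord_mem_closure_shallow (hσ : ContDiff ℝ 2 σ)
    (h : ¬ ∃ a b : ℝ, ∀ t, σ t = a * t + b) (i : Fin m) :
    (⟨fun x => x i, by fun_prop⟩ : C(Fin m → ℝ, ℝ)) ∈ (shallow σ m).topologicalClosure := by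
  simpa using linear_mem_closure_shallow (hσ.differentiable two_ne_zero) h (Pi.single i 1)

lemma mul_coord_mem_closure_shallow (hσ : ContDiff ℝ 2 σ)
    (h : ¬ ∃ a b : ℝ, ∀ t, σ t = a * t + b) (i j : Fin m) :
    (⟨fun x => x i * x j, by fun_prop⟩ : C(Fin m → ℝ, ℝ)) ∈ (shallow σ m).topologicalClosure := by
  have := (shallow σ m).topologicalClosure.smul_mem (1 / 2) <|
    (shallow σ m).topologicalClosure.sub_mem
      ((shallow σ m).topologicalClosure.sub_mem
        (sq_mem_closure_shallow hσ h (Pi.single i 1 + Pi.single j 1))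
        (sq_mem_closure_shallow hσ h (Pi.single i 1)))
      (sq_mem_closure_shallow hσ h (Pi.single j 1))
  convert this using 1
  ext x
  simp
  ring

end shallow_closure

/-- `(z, t) ↦ snoc z t` for continuous functions. -/
def ContinuousMap.snoc {T : Type*} [TopologicalSpace T] {k : ℕ} (g : C(T, Fin k → ℝ))
    (f : C(T, ℝ)) : C(T, Fin (k + 1) → ℝ) where
  toFun z := Fin.snoc (g z) (f z)
  continuous_toFun := by
    refine continuous_pi fun i => ?_
    refine Fin.lastCases ?_ (fun j => ?_) i
    · simpa using f.continuous
    · simpa [Function.comp_def] using (continuous_apply j).comp g.continuous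

/-- `f` can be computed alongside any other data. -/
def IsAdjoinable (σ : C(ℝ, ℝ)) {m : ℕ} (f : C(Fin m → ℝ, ℝ)) : Prop :=
  ∀ (k : ℕ) (A : (Fin k → ℝ) →L[ℝ] (Fin m → ℝ)),
    (ContinuousMap.id (Fin k → ℝ)).snoc (f.comp (A : C(Fin k → ℝ, Fin m → ℝ))) ∈
      NeuralNet.approximable σ k (k + 1)

/-- For fixed `k` and `A` the augmented map depends continuously on `f` in the compact-open
topology, and the approximable maps form a closed set. -/
lemma isClosed_isAdjoinable (σ : C(ℝ, ℝ)) (m : ℕ) :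
    IsClosed {f : C(Fin m → ℝ, ℝ) | IsAdjoinable σ f} := by
  simp only [IsAdjoinable, Set.ofPred_forall]
  refine isClosed_iInter fun k => isClosed_iInter fun A => isClosed_closure.preimage ?_
  refine ContinuousMap.continuous_of_continuous_uncurry _ ?_
  refine continuous_pi fun i => ?_
  refine Fin.lastCases ?_ (fun j => ?_) i
  · simp only [Function.uncurry_def, ContinuousMap.snoc, ContinuousMap.coe_mk, Fin.snoc_last,
      ContinuousMap.comp_apply]
    exact continuous_eval.comp (continuous_fst.prodMk (by fun_prop))
  · simp only [Function.uncurry_def, ContinuousMap.snoc, ContinuousMap.coe_mk, Fin.snoc_castSucc,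
      ContinuousMap.id_apply]
    fun_prop

section adjoinable

variable {σ : C(ℝ, ℝ)} {m : ℕ}

/-- Binary operations that are given by one hidden layer preserve adjoinability. -/
lemma IsAdjoinable.binop
    (hσ : ContDiff ℝ 2 σ) (h : ¬ ∃ a b : ℝ, ∀ t, σ t = a * t + b)
    {f g : C(Fin m → ℝ, ℝ)} (hf : IsAdjoinable σ f) (hg : IsAdjoinable σ g)
    (B : C(ℝ × ℝ, ℝ))
    (hB : ∀ k : ℕ, ∀ i j : Fin k, (⟨fun x => B (x i, x j), by fun_prop⟩ : C(Fin k → ℝ, ℝ)) ∈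
      (shallow σ k).topologicalClosure) :
    IsAdjoinable σ (B.comp (f.prodMk g)) := by
  intro k A
  let front : (Fin (k + 1) → ℝ) →L[ℝ] (Fin k → ℝ) :=
    ContinuousLinearMap.pi fun i => ContinuousLinearMap.proj i.castSucc
  -- Append `f`, then `g`; the second stage reads the original input through `front`. A last layer
  -- keeps the data and merges the two new entries by `B`.
  have h1 := NeuralNet.comp_mem_approximable (hf k A) (hg (k + 1) (A.comp front))
  let last : Fin (k + 1) → C(Fin (k + 1 + 1) → ℝ, ℝ) :=
    Fin.snoc (α := fun _ => C(Fin (k + 1 + 1) → ℝ, ℝ))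
      (fun i => ⟨fun x => x i.castSucc.castSucc, by fun_prop⟩)
      ⟨fun x => B (x (Fin.last k).castSucc, x (Fin.last (k + 1))), by fun_prop⟩
  have h2 : ContinuousMap.pi last ∈ NeuralNet.approximable σ (k + 1 + 1) (k + 1) := by
    refine pi_mem_approximable fun i => ?_
    refine Fin.lastCases ?_ (fun j => ?_) i
    · simpa [last] using hB _ _ _
    · simpa [last] using coord_mem_closure_shallow hσ h _
  have h3 := NeuralNet.comp_mem_approximable h1 h2
  convert h3 using 1
  ext x i
  have hfront : front (Fin.snoc x (f (A x))) = x := by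
    ext j; simp [front]
  refine Fin.lastCases ?_ (fun j => ?_) i
  · simp [last, ContinuousMap.snoc, hfront]
  · simp [last, ContinuousMap.snoc]

lemma isAdjoinable_of_forall_comp_mem
    (hσ : ContDiff ℝ 2 σ) (h : ¬ ∃ a b : ℝ, ∀ t, σ t = a * t + b)
    {f : C(Fin m → ℝ, ℝ)}
    (hf : ∀ (k : ℕ) (A : (Fin k → ℝ) →L[ℝ] (Fin m → ℝ)),
      f.comp (A : C(Fin k → ℝ, Fin m → ℝ)) ∈ (shallow σ k).topologicalClosure) :
    IsAdjoinable σ f := by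
  intro k A
  let F : Fin (k + 1) → C(Fin k → ℝ, ℝ) := Fin.snoc (α := fun _ => C(Fin k → ℝ, ℝ))
    (fun i => ⟨fun x => x i, by fun_prop⟩) (f.comp (A : C(Fin k → ℝ, Fin m → ℝ)))
  have h1 : ContinuousMap.pi F ∈ NeuralNet.approximable σ k (k + 1) := by
    refine pi_mem_approximable fun i => ?_
    refine Fin.lastCases ?_ (fun j => ?_) i
    · simpa [F] using hf k A
    · simpa [F] using coord_mem_closure_shallow hσ h j
  convert h1 using 1
  ext x i
  refine Fin.lastCases ?_ (fun j => ?_) i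
  · simp [F, ContinuousMap.snoc]
  · simp [F, ContinuousMap.snoc]

lemma isAdjoinable_coord
    (hσ : ContDiff ℝ 2 σ) (h : ¬ ∃ a b : ℝ, ∀ t, σ t = a * t + b)
    (i : Fin m) :
    IsAdjoinable σ (⟨fun x => x i, by fun_prop⟩ : C(Fin m → ℝ, ℝ)) := by
  refine isAdjoinable_of_forall_comp_mem hσ h fun k A => ?_
  have := linear_mem_closure_shallow (hσ.differentiable two_ne_zero) h
    (LinearMap.toMatrix' (A : (Fin k → ℝ) →ₗ[ℝ] (Fin m → ℝ)) i)
  convert this using 1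
  ext x
  exact (congrFun (LinearMap.toMatrix'_mulVec (A : (Fin k → ℝ) →ₗ[ℝ] (Fin m → ℝ)) x) i).symm

lemma isAdjoinable_const
    (hσ : ContDiff ℝ 2 σ) (h : ¬ ∃ a b : ℝ, ∀ t, σ t = a * t + b)
    (r : ℝ) :
    IsAdjoinable σ (algebraMap ℝ C(Fin m → ℝ, ℝ) r) := by
  refine isAdjoinable_of_forall_comp_mem hσ h fun k A => ?_
  have := (shallow σ k).topologicalClosure.smul_mem r (one_mem_closure_shallow h)
  convert this using 1
  ext x
  simp

/-- Every continuous function can be computed alongside any other data. -/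
lemma isAdjoinable
    (hσ : ContDiff ℝ 2 σ) (h : ¬ ∃ a b : ℝ, ∀ t, σ t = a * t + b)
    (f : C(Fin m → ℝ, ℝ)) : IsAdjoinable σ f := by
  -- Adjoinable functions form a closed algebra that separates points, so Stone–Weierstrass on
  -- compact sets gives everything.
  let 𝒜 : Subalgebra ℝ C(Fin m → ℝ, ℝ) :=
    { carrier := {f | IsAdjoinable σ f}
      mul_mem' := fun {f g} hf hg => IsAdjoinable.binop hσ h hf hg ⟨fun p => p.1 * p.2, by fun_prop⟩
        fun k i j => mul_coord_mem_closure_shallow hσ h i j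
      add_mem' := fun {f g} hf hg => IsAdjoinable.binop hσ h hf hg ⟨fun p => p.1 + p.2, by fun_prop⟩
        fun k i j => (shallow σ k).topologicalClosure.add_mem (coord_mem_closure_shallow hσ h i)
          (coord_mem_closure_shallow hσ h j)
      algebraMap_mem' := isAdjoinable_const hσ h }
  have hsep : 𝒜.SeparatesPoints := by
    intro x y hxy
    obtain ⟨i, hi⟩ := Function.ne_iff.1 hxy
    exact ⟨_, ⟨⟨fun x => x i, by fun_prop⟩, isAdjoinable_coord hσ h i, rfl⟩, hi⟩
  have hcl : f ∈ closure {f : C(Fin m → ℝ, ℝ) | IsAdjoinable σ f} := by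
    refine ContinuousMap.mem_closure_iff_forall_isCompact.2 fun K hK δ hδ => ?_
    obtain ⟨g, hg, hgf⟩ :=
      ContinuousMap.exists_mem_subalgebra_near_continuous_of_isCompact_of_separatesPoints
        hsep f hK hδ
    exact ⟨g, hg, fun x hx => by rw [dist_comm, dist_eq_norm]; exact hgf x hx⟩
  rwa [(isClosed_isAdjoinable σ m).closure_eq] at hcl

/-- Universal approximation theorem for deep networks with a smooth activation that is not
affine. -/
theorem NeuralNet.approximable_eq_univ
    (hσ : ContDiff ℝ 2 σ) (h : ¬ ∃ a b : ℝ, ∀ t, σ t = a * t + b)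
    (k : ℕ) :
    NeuralNet.approximable σ m k = Set.univ := by
  refine Set.eq_univ_of_forall fun f => ?_
  -- Induction on the number of outputs: `A` recovers the input, still needed for the next
  -- component, and `B` reads off those already computed.
  suffices H : ∀ k : ℕ, ∀ f : C(Fin m → ℝ, Fin k → ℝ), ∃ (d : ℕ) (g : C(Fin m → ℝ, Fin d → ℝ))
      (A : (Fin d → ℝ) →L[ℝ] (Fin m → ℝ)) (B : (Fin d → ℝ) →L[ℝ] (Fin k → ℝ)),
      g ∈ NeuralNet.approximable σ m d ∧ (∀ x, A (g x) = x) ∧ ∀ x, B (g x) = f x by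
    obtain ⟨d, g, A, B, hg, -, hB⟩ := H k f
    have := NeuralNet.comp_mem_approximable hg (NeuralNet.linear_mem_approximable σ B)
    convert this using 1
    ext1 x
    exact (hB x).symm
  intro k
  induction k with
  | zero =>
    intro f
    refine ⟨m, ContinuousMap.id _, ContinuousLinearMap.id ℝ _, 0,
      NeuralNet.linear_mem_approximable σ (ContinuousLinearMap.id ℝ _), fun _ => rfl,
      fun _ => Subsingleton.elim _ _⟩
  | succ k ih =>
    intro f
    obtain ⟨d, g, A, B, hg, hA, hB⟩ := ih ⟨fun x i => f x i.castSucc, by fun_prop⟩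
    let front : (Fin (d + 1) → ℝ) →L[ℝ] (Fin d → ℝ) :=
      ContinuousLinearMap.pi fun i => ContinuousLinearMap.proj i.castSucc
    let fl : C(Fin m → ℝ, ℝ) := ⟨fun x => f x (Fin.last k), by fun_prop⟩
    have hfront : ∀ (z : Fin d → ℝ) (t : ℝ), front (Fin.snoc z t) = z := fun z t => by
      ext j; simp [front]
    refine ⟨d + 1, _, A.comp front, ContinuousLinearMap.pi (Fin.snoc (α := fun _ => _)
      (fun i => (ContinuousLinearMap.proj i).comp (B.comp front))
      (ContinuousLinearMap.proj (Fin.last d))),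
      NeuralNet.comp_mem_approximable hg (isAdjoinable hσ h fl d A), fun x => ?_, fun x => ?_⟩
    · simp [ContinuousMap.snoc, hfront, hA]
    · ext i
      refine Fin.lastCases ?_ (fun j => ?_) i
      · simp [ContinuousMap.snoc, hA, fl]
      · simp [ContinuousMap.snoc, hfront, hB]

/-- Universal approximation in quantitative form. -/
theorem NeuralNet.exists_eval_near
    (hσ : ContDiff ℝ 2 σ) (h : ¬ ∃ a b : ℝ, ∀ t, σ t = a * t + b)
    {k : ℕ} (f : C(Fin m → ℝ, Fin k → ℝ)) {K : Set (Fin m → ℝ)}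
    (hK : IsCompact K) {δ : ℝ} (hδ : 0 < δ) :
    ∃ N : NeuralNet m k, ∀ x ∈ K, ∀ i, |N.eval σ x i - f x i| < δ := by
  have hf : f ∈ NeuralNet.approximable σ m k := by
    rw [NeuralNet.approximable_eq_univ hσ h]; trivial
  obtain ⟨_, ⟨N, rfl⟩, hN⟩ := ContinuousMap.mem_closure_iff_forall_isCompact.1 hf K hK δ hδ
  refine ⟨N, fun x hx i => ?_⟩
  have := (dist_le_pi_dist _ _ i).trans_lt (hN x hx)
  rwa [dist_comm, Real.dist_eq] at this

end adjoinable

/-! ### Lebesgue measure on the state space -/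

/-- Lebesgue measure on a compact set. -/
noncomputable abbrev compactsVolume {n : ℕ} (X : Compacts (EuclideanSpace ℝ (Fin n))) : Measure X :=
  Measure.comap Subtype.val (volume : Measure (EuclideanSpace ℝ (Fin n)))

section

variable {n : ℕ} (X : Compacts (EuclideanSpace ℝ (Fin n)))

lemma measurableEmbedding_compacts_val :
    MeasurableEmbedding (Subtype.val : X → EuclideanSpace ℝ (Fin n)) :=
  MeasurableEmbedding.subtype_coe X.isCompact.isClosed.measurableSet

instance isFiniteMeasure_compactsVolume : IsFiniteMeasure (compactsVolume X) := by
  refine ⟨?_⟩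
  rw [(measurableEmbedding_compacts_val X).comap_apply]
  refine lt_of_le_of_lt (measure_mono ?_) X.isCompact.measure_lt_top
  rintro _ ⟨y, -, rfl⟩
  exact y.2

/-- Near each of its points `X` has interior points `p + t • e`, so a nonempty relatively open set
contains a nonempty open set of the ambient space. -/
lemma isOpenPosMeasure_compactsVolume
    (hX : ∀ p ∈ frontier (X : Set (EuclideanSpace ℝ (Fin n))),
      HasLipschitzBoundaryAt (X : Set (EuclideanSpace ℝ (Fin n))) p) :
    (compactsVolume X).IsOpenPosMeasure := by
  refine ⟨fun U hU ⟨p, hp⟩ => ?_⟩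
  obtain ⟨O, hO, rfl⟩ := isOpen_induced_iff.1 hU
  rw [(measurableEmbedding_compacts_val X).comap_apply]
  obtain ⟨e, r, hr, hcone⟩ := hasInteriorConeAt_of_isClosed X.isCompact.isClosed (hX p) p.2
  have hlim : Filter.Tendsto (fun t : ℝ => (p : EuclideanSpace ℝ (Fin n)) + t • e)
      (nhdsWithin 0 (Set.Ioi 0)) (nhds p) := by
    have h : Filter.Tendsto (fun t : ℝ => (p : EuclideanSpace ℝ (Fin n)) + t • e) (nhds 0)
        (nhds (p + (0 : ℝ) • e)) := Continuous.tendsto (by fun_prop) 0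
    rw [zero_smul, add_zero] at h
    exact h.mono_left nhdsWithin_le_nhds
  obtain ⟨t, ht, htO⟩ := ((Filter.Eventually.and (Ioo_mem_nhdsGT hr)) (hlim.eventually (hO.mem_nhds hp))).exists
  have hint := hcone p p.2 (by simpa using hr) t ht.1 ht.2 e (by simpa using hr)
  have hpos : 0 < volume (O ∩ interior (X : Set (EuclideanSpace ℝ (Fin n)))) :=
    (hO.inter isOpen_interior).measure_pos _ ⟨_, htO, hint⟩
  refine (hpos.trans_le (measure_mono ?_)).ne'
  rintro y ⟨hyO, hyX⟩
  exact ⟨⟨y, interior_subset hyX⟩, hyO, rfl⟩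

instance compactSpace_compacts : CompactSpace X := isCompact_iff_compactSpace.1 X.isCompact

variable {X}

lemma integrable_compactsVolume {F : Type*} [NormedAddCommGroup F] {f : X → F}
    (hf : Continuous f) : Integrable f (compactsVolume X) :=
  hf.integrable_of_hasCompactSupport (HasCompactSupport.of_compactSpace f)

/-- The functional `c ↦ ∫_X φ c`. -/
noncomputable def moment (φ : C(EuclideanSpace ℝ (Fin n), ℝ)) (c : C(X, ℝ)) : ℝ :=
  ∫ y : X, φ y * c y ∂(compactsVolume X)

lemma abs_moment_le (φ : C(EuclideanSpace ℝ (Fin n), ℝ)) {c : C(X, ℝ)} {Φ θ : ℝ}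
    (hφ : ∀ y : X, |φ y| ≤ Φ) (hc : ∀ y, |c y| ≤ θ) :
    |moment φ c| ≤ Φ * θ * (compactsVolume X).real Set.univ := by
  refine norm_integral_le_of_norm_le_const (μ := compactsVolume X)
    (f := fun y : X => φ y * c y) (Filter.Eventually.of_forall fun y => ?_)
  rw [norm_mul]
  exact mul_le_mul (hφ y) (hc y) (abs_nonneg _) ((abs_nonneg _).trans (hφ y))

lemma exists_forall_abs_le (φ : C(EuclideanSpace ℝ (Fin n), ℝ)) :
    ∃ Φ : ℝ, 0 ≤ Φ ∧ ∀ y : X, |φ y| ≤ Φ :=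
  let ψ : C(X, ℝ) := ⟨fun y => φ y, by fun_prop⟩
  ⟨‖ψ‖, norm_nonneg _, fun y => ψ.norm_coe_le_norm y⟩

lemma moment_sub (φ : C(EuclideanSpace ℝ (Fin n), ℝ)) (c c' : C(X, ℝ)) :
    moment φ (c - c') = moment φ c - moment φ c' := by
  unfold moment
  rw [← integral_sub (integrable_compactsVolume (by fun_prop))
    (integrable_compactsVolume (by fun_prop))]
  simp [mul_sub]

lemma moment_smul (t : ℝ) (φ : C(EuclideanSpace ℝ (Fin n), ℝ)) (c : C(X, ℝ)) :
    moment (t • φ) c = t * moment φ c := by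
  simp [moment, mul_assoc, integral_const_mul]

lemma continuous_moment (φ : C(EuclideanSpace ℝ (Fin n), ℝ)) :
    Continuous fun c : C(X, ℝ) => moment φ c := by
  obtain ⟨Φ, hΦ, hφ⟩ := exists_forall_abs_le (X := X) φ
  refine (LipschitzWith.of_dist_le_mul
    (K := (Φ * (compactsVolume X).real Set.univ).toNNReal) fun c c' => ?_).continuous
  rw [Real.coe_toNNReal _ (by positivity), Real.dist_eq, ← moment_sub, dist_eq_norm]
  have := abs_moment_le φ (c := c - c') hφ fun y => (c - c').norm_coe_le_norm y
  linarith

/-! ### Density of functions of finitely many nonlocal neurons -/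

/-- Functions of `(c, x)` that depend on `c` through finitely many values `σ(b + ∫ φᵢ c)`. -/
def nonlocalAlgebra (σ : C(ℝ, ℝ)) (b : ℝ) (X : Compacts (EuclideanSpace ℝ (Fin n))) :
    Subalgebra ℝ C(C(X, ℝ) × X, ℝ) where
  carrier := {f | ∃ (m : ℕ) (φ : Fin m → C(EuclideanSpace ℝ (Fin n), ℝ))
    (P : C((Fin m → ℝ) × EuclideanSpace ℝ (Fin n), ℝ)),
    ∀ c x, f (c, x) = P (fun i => σ (b + moment (φ i) c), x)}
  mul_mem' := by
    rintro f g ⟨m, φ, P, hf⟩ ⟨m', φ', P', hg⟩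
    refine ⟨m + m', Fin.append φ φ', ⟨fun p => P (fun i => p.1 (Fin.castAdd m' i), p.2) *
      P' (fun i => p.1 (Fin.natAdd m i), p.2), by fun_prop⟩, fun c x => ?_⟩
    simp [hf, hg]
  add_mem' := by
    rintro f g ⟨m, φ, P, hf⟩ ⟨m', φ', P', hg⟩
    refine ⟨m + m', Fin.append φ φ', ⟨fun p => P (fun i => p.1 (Fin.castAdd m' i), p.2) +
      P' (fun i => p.1 (Fin.natAdd m i), p.2), by fun_prop⟩, fun c x => ?_⟩
    simp [hf, hg]
  algebraMap_mem' r := ⟨0, Fin.elim0, algebraMap ℝ _ r, fun c x => by simp⟩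

lemma exists_moment_ne [(compactsVolume X).IsOpenPosMeasure] {c c' : C(X, ℝ)} (h : c ≠ c') :
    ∃ φ : C(EuclideanSpace ℝ (Fin n), ℝ), moment φ c ≠ moment φ c' := by
  -- Tietze extension of `c - c'`: the two moments then differ by `∫ (c - c') ^ 2 > 0`.
  obtain ⟨φ, hφ⟩ := ContinuousMap.exists_extension
    (X.isCompact.isClosed.isClosedEmbedding_subtypeVal) (c - c')
  obtain ⟨x, hx⟩ := DFunLike.ne_iff.1 h
  refine ⟨φ, fun heq => ?_⟩
  have h1 : moment φ (c - c') = 0 := by rw [moment_sub, heq, sub_self]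
  have h2 : ∀ y : X, φ y = c y - c' y := fun y => DFunLike.congr_fun hφ y
  have hpos : 0 < ∫ y : X, φ y * (c - c') y ∂(compactsVolume X) := by
    refine Continuous.integral_pos_of_hasCompactSupport_nonneg_nonzero (x := x) (by fun_prop)
      (HasCompactSupport.of_compactSpace _) (fun y => ?_) ?_
    · simp only [h2, ContinuousMap.sub_apply]
      exact mul_self_nonneg _
    · simp only [h2, ContinuousMap.sub_apply]
      exact mul_self_ne_zero.2 (sub_ne_zero.2 hx)
  exact hpos.ne' h1

lemma separatesPoints_nonlocalAlgebra [(compactsVolume X).IsOpenPosMeasure] {σ : C(ℝ, ℝ)} {b : ℝ}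
    (hb : deriv σ b ≠ 0) : (nonlocalAlgebra σ b X).SeparatesPoints := by
  rintro ⟨c, x⟩ ⟨c', x'⟩ hne
  by_cases hc : c = c'
  · have hx : (x : EuclideanSpace ℝ (Fin n)) ≠ x' := fun h => hne (by rw [hc, Subtype.ext h])
    obtain ⟨i, hi⟩ : ∃ i, (x : EuclideanSpace ℝ (Fin n)) i ≠ (x' : EuclideanSpace ℝ (Fin n)) i := by
      by_contra! hcon
      exact hx (PiLp.ext hcon)
    exact ⟨_, ⟨⟨fun p => (p.2 : EuclideanSpace ℝ (Fin n)) i, by fun_prop⟩,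
      ⟨0, Fin.elim0, ⟨fun p => p.2 i, by fun_prop⟩, fun c x => rfl⟩, rfl⟩, hi⟩
  · obtain ⟨φ, hφ⟩ := exists_moment_ne hc
    -- `σ` need not be injective. If every `t` failed, differentiating at `t = 0` would make the two
    -- moments equal.
    obtain ⟨t, ht⟩ : ∃ t : ℝ, σ (b + t * moment φ c) ≠ σ (b + t * moment φ c') := by
      by_contra! hcon
      have hd : DifferentiableAt ℝ σ b := differentiableAt_of_deriv_ne_zero hb
      have h : ∀ a : ℝ, HasDerivAt (fun t : ℝ => σ (b + t * a)) (deriv σ b * a) 0 := fun a => by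
        have h1 : HasDerivAt (fun t : ℝ => b + t * a) a 0 := by
          simpa using ((hasDerivAt_id (0 : ℝ)).mul_const a).const_add b
        exact HasDerivAt.comp (h₂ := σ) 0 (by simpa using hd.hasDerivAt) h1
      have h1 := h (moment φ c)
      rw [funext hcon] at h1
      exact hφ (mul_left_cancel₀ hb (h1.unique (h (moment φ c'))))
    have hcont := continuous_moment (X := X) (t • φ)
    refine ⟨_, ⟨⟨fun p => σ (b + moment (t • φ) p.1), by fun_prop⟩,
      ⟨1, fun _ => t • φ, ⟨fun p => p.1 0, by fun_prop⟩, fun c x => rfl⟩, rfl⟩, ?_⟩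
    simpa [moment_smul] using ht

/-! ### Realisation by neural operators -/

lemma isCompact_finAppend_compacts (θ : ℝ) : IsCompact (Set.range fun p : Set.Icc (-θ) θ × X =>
    (Fin.append (fun _ => (p.1 : ℝ)) (fun a => (p.2 : EuclideanSpace ℝ (Fin n)) a) :
      Fin (1 + n) → ℝ)) :=
  isCompact_range (continuous_finAppend (by fun_prop) (by fun_prop))

variable {σ : C(ℝ, ℝ)}

/-- A lifting network close to `(t, x) ↦ (t, …, t)`. -/
lemma exists_lift_near
    (hσ : ContDiff ℝ 2 σ) (h : ¬ ∃ a b : ℝ, ∀ t, σ t = a * t + b)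
    (m : ℕ) (θ : ℝ) {δ : ℝ} (hδ : 0 < δ) :
    ∃ R : NeuralNet (1 + n) m, ∀ t : ℝ, |t| ≤ θ → ∀ (y : X) (i : Fin m),
      |R.eval σ (Fin.append (fun _ => t) (fun a => (y : EuclideanSpace ℝ (Fin n)) a)) i - t|
        < δ := by
  obtain ⟨R, hR⟩ := NeuralNet.exists_eval_near hσ h
    (⟨fun z _ => z (Fin.castAdd n 0), by fun_prop⟩ : C(Fin (1 + n) → ℝ, Fin m → ℝ))
    (isCompact_finAppend_compacts (X := X) θ) hδ
  refine ⟨R, fun t ht y i => ?_⟩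
  have := hR _ ⟨(⟨t, abs_le.1 ht⟩, y), rfl⟩ i
  simpa using this

/-- A kernel network close to the diagonal kernel `diag (φ₁(y), …, φ_m(y))`. -/
lemma exists_kernel_near
    (hσ : ContDiff ℝ 2 σ) (h : ¬ ∃ a b : ℝ, ∀ t, σ t = a * t + b)
    {m : ℕ} (φ : Fin m → C(EuclideanSpace ℝ (Fin n), ℝ)) (b : Fin m → ℝ)
    {δ : ℝ} (hδ : 0 < δ) :
    ∃ K : NeuralNet (n + n) (m * m), ∀ (x y : X) (i j : Fin m),
      |(HiddenLayer.mk 0 b K).kernelMatrix σ x y i j - if i = j then φ i y else 0| < δ := by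
  have hK : IsCompact (Set.range fun p : X × X =>
      Fin.append (fun a => (p.1 : EuclideanSpace ℝ (Fin n)) a)
        (fun a => (p.2 : EuclideanSpace ℝ (Fin n)) a)) :=
    isCompact_range (continuous_finAppend (by fun_prop) (by fun_prop))
  let f : C(Fin (n + n) → ℝ, Fin (m * m) → ℝ) :=
    ⟨fun z k => if (finProdFinEquiv.symm k).1 = (finProdFinEquiv.symm k).2 then
      φ (finProdFinEquiv.symm k).1 (WithLp.toLp 2 fun a => z (Fin.natAdd n a)) else 0, by
      refine continuous_pi fun k => ?_
      split_ifs
      · fun_prop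
      · fun_prop⟩
  obtain ⟨K, hK⟩ := NeuralNet.exists_eval_near hσ h f hK hδ
  refine ⟨K, fun x y i j => ?_⟩
  have h1 := hK _ ⟨(x, y), rfl⟩ (finProdFinEquiv (i, j))
  simpa only [HiddenLayer.kernelMatrix, Matrix.of_apply, f, ContinuousMap.coe_mk,
    Equiv.symm_apply_apply, Fin.append_right, WithLp.toLp_ofLp] using h1

/-- The lift puts a copy of `c` in each channel and the kernel is nearly `diag (φ₁(y), …, φ_m(y))`,
so channel `i` integrates to nearly `∫ φᵢ c`. The networks are chosen uniformly over all `c` bounded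
by `θ`. -/
lemma exists_nonlocal_near
    (hσ : ContDiff ℝ 2 σ) (h : ¬ ∃ a b : ℝ, ∀ t, σ t = a * t + b)
    {m : ℕ} (φ : Fin m → C(EuclideanSpace ℝ (Fin n), ℝ)) (b : Fin m → ℝ)
    {θ : ℝ} (hθ : 0 ≤ θ) {ρ : ℝ} (hρ : 0 < ρ) :
    ∃ (R : NeuralNet (1 + n) m) (K : NeuralNet (n + n) (m * m)),
      ∀ (c : C(X, ℝ)) (v : C(X, Fin m → ℝ)), (∀ x, |c x| ≤ θ) →
      (∀ x : X, v x = R.eval σ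
        (Fin.append (fun _ => c x) (fun a => (x : EuclideanSpace ℝ (Fin n)) a))) →
      ∀ (x : X) (i : Fin m),
        |(HiddenLayer.mk 0 b K).nonlocal σ v x i - moment (φ i) c| < ρ := by
  obtain ⟨Φ, hΦ, hφ⟩ : ∃ Φ : ℝ, 0 ≤ Φ ∧ ∀ (i : Fin m) (y : X), |φ i y| ≤ Φ := by
    choose Φ hΦ hφ using fun i => exists_forall_abs_le (X := X) (φ i)
    exact ⟨∑ i, Φ i, Finset.sum_nonneg fun i _ => hΦ i, fun i y => (hφ i y).trans
      (Finset.single_le_sum (fun i _ => hΦ i) (Finset.mem_univ i))⟩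
  set vol := (compactsVolume X).real Set.univ with hvol
  have hvol0 : 0 ≤ vol := measureReal_nonneg
  set C : ℝ := m * (Φ + 1 + θ) * vol with hC
  have hC0 : 0 ≤ C := by positivity
  obtain ⟨δ, hδ0, hδ1, hδC⟩ : ∃ δ : ℝ, 0 < δ ∧ δ ≤ 1 ∧ δ * C < ρ := by
    refine ⟨min 1 (ρ / (C + 1)), by positivity, min_le_left _ _, ?_⟩
    calc _ ≤ ρ / (C + 1) * C := by gcongr; exact min_le_right _ _
      _ < ρ := by rw [div_mul_eq_mul_div, div_lt_iff₀ (by positivity)]; nlinarith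
  obtain ⟨R, hR⟩ := exists_lift_near (X := X) hσ h m θ hδ0
  obtain ⟨K, hK⟩ := exists_kernel_near (X := X) hσ h φ b hδ0
  refine ⟨R, K, fun c v hc hv x i => ?_⟩
  set M := fun y : X => (HiddenLayer.mk 0 b K).kernelMatrix σ x y with hM
  have hMcont : Continuous M :=
    ((HiddenLayer.mk 0 b K).continuous_kernelMatrix σ).comp
      (f := fun y : X => ((x : EuclideanSpace ℝ (Fin n)), (y : EuclideanSpace ℝ (Fin n))))
      (by fun_prop)
  have hMv : Continuous fun y => (M y).mulVec (v y) :=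
    hMcont.matrix_mulVec v.continuous
  have hMvi : ∀ i, Continuous fun y => (M y).mulVec (v y) i := fun i => (continuous_apply i).comp hMv
  have hnl : (HiddenLayer.mk 0 b K).nonlocal σ v x i
      = ∫ y, (M y).mulVec (v y) i ∂(compactsVolume X) :=
    eval_integral (fun i => integrable_compactsVolume (hMvi i)) i
  have hbound : ∀ y : X, |(M y).mulVec (v y) i - φ i y * c y| ≤ δ * (m * (Φ + 1 + θ)) := by
    intro y
    have h1 : (M y).mulVec (v y) i - φ i y * c y
        = ∑ j, (M y i j * v y j - (if i = j then φ i y else 0) * c y) := by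
      rw [Finset.sum_sub_distrib]
      simp [Matrix.mulVec, dotProduct]
    rw [h1]
    refine (Finset.abs_sum_le_sum_abs _ _).trans ?_
    have h2 : ∀ j ∈ Finset.univ, |M y i j * v y j - (if i = j then φ i y else 0) * c y|
        ≤ δ * (Φ + 1 + θ) := by
      intro j _
      have hk := (hK x y i j).le
      have hr := (hR (c y) (hc y) y j).le
      rw [← hv y] at hr
      have hφ' : |if i = j then φ i y else 0| ≤ Φ := by
        split_ifs
        · exact hφ i y
        · simpa using hΦ
      set k := M y i j
      set p := if i = j then φ i y else 0
      have hkb : |k| ≤ Φ + 1 := by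
        have := abs_sub_abs_le_abs_sub k p
        linarith
      calc |k * v y j - p * c y| = |k * (v y j - c y) + (k - p) * c y| := by ring_nf
        _ ≤ |k| * |v y j - c y| + |k - p| * |c y| := by
          rw [← abs_mul, ← abs_mul]; exact abs_add_le _ _
        _ ≤ (Φ + 1) * δ + δ * θ := by gcongr; exact hc y
        _ = δ * (Φ + 1 + θ) := by ring
    refine (Finset.sum_le_card_nsmul _ _ _ h2).trans (le_of_eq ?_)
    simp
    ring
  rw [hnl, moment, ← integral_sub (integrable_compactsVolume (hMvi i))
    (integrable_compactsVolume (by fun_prop))]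
  calc |∫ y, ((M y).mulVec (v y) i - φ i y * c y) ∂(compactsVolume X)|
      ≤ δ * (m * (Φ + 1 + θ)) * vol :=
        norm_integral_le_of_norm_le_const (μ := compactsVolume X)
          (f := fun y : X => (M y).mulVec (v y) i - φ i y * c y)
          (Filter.Eventually.of_forall hbound)
    _ = δ * C := by rw [hC]; ring
    _ < ρ := hδC

/-- Functions of finitely many nonlocal neurons are limits of neural operators with one hidden
layer. -/
lemma exists_neuralOperator_near
    (hσ : ContDiff ℝ 2 σ) (h : ¬ ∃ a b : ℝ, ∀ t, σ t = a * t + b)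
    {m : ℕ} (φ : Fin m → C(EuclideanSpace ℝ (Fin n), ℝ)) (b : ℝ)
    (P : C((Fin m → ℝ) × EuclideanSpace ℝ (Fin n), ℝ)) {θ : ℝ} (hθ : 0 ≤ θ) {δ : ℝ} (hδ : 0 < δ) :
    ∃ N : NeuralOperator n, ∀ c : C(X, ℝ), (∀ x, |c x| ≤ θ) → ∀ x : X,
      |N.eval σ c x - P (fun i => σ (b + moment (φ i) c), x)| < δ := by
  obtain ⟨M, hM⟩ : ∃ M : ℝ, ∀ c : C(X, ℝ), (∀ x, |c x| ≤ θ) → ∀ i, |moment (φ i) c| ≤ M := by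
    choose Φ hΦ hφ using fun i => exists_forall_abs_le (X := X) (φ i)
    refine ⟨∑ i, Φ i * θ * (compactsVolume X).real Set.univ, fun c hc i =>
      (abs_moment_le (φ i) (hφ i) hc).trans
        (Finset.single_le_sum (f := fun i => Φ i * θ * (compactsVolume X).real Set.univ)
          (fun i _ => ?_) (Finset.mem_univ i))⟩
    have := hΦ i
    positivity
  -- The margin `1` leaves room for the error of the approximate moments, which stays below `min ρ
  -- 1`.
  set box : Set (Fin m → ℝ) := Set.univ.pi fun _ => Set.Icc (-(M + 1)) (M + 1) with hbox
  have hboxc : IsCompact box := isCompact_univ_pi fun _ => isCompact_Icc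
  let act : (Fin m → ℝ) → (Fin m → ℝ) := fun u i => σ (b + u i)
  have hact : Continuous act := by fun_prop
  have hunif : UniformContinuousOn
      (fun p : (Fin m → ℝ) × EuclideanSpace ℝ (Fin n) => P (act p.1, p.2)) (box ×ˢ X) :=
    (hboxc.prod X.isCompact).uniformContinuousOn_of_continuous (by fun_prop)
  obtain ⟨ρ, hρ, hρP⟩ := Metric.uniformContinuousOn_iff.1 hunif (δ / 2) (half_pos hδ)
  obtain ⟨R, K, hRK⟩ := exists_nonlocal_near (X := X) hσ h φ (fun _ => b) hθ
    (lt_min hρ zero_lt_one)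
  have hcomp : IsCompact ((fun p : (Fin m → ℝ) × EuclideanSpace ℝ (Fin n) =>
      (Fin.append (act p.1) (fun a => p.2 a) : Fin (m + n) → ℝ)) '' (box ×ˢ X)) :=
    (hboxc.prod X.isCompact).image (continuous_finAppend (by fun_prop) (by fun_prop))
  obtain ⟨Q, hQ⟩ := NeuralNet.exists_eval_near hσ h
    (⟨fun z _ => P (fun i => z (Fin.castAdd n i), WithLp.toLp 2 fun a => z (Fin.natAdd m a)),
      by fun_prop⟩ : C(Fin (m + n) → ℝ, Fin 1 → ℝ)) hcomp (half_pos hδ)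
  -- With local weight `0` the layer outputs `σ (b + u i)`, `u` being the approximate moments; `Q`
  -- approximates `P`.
  refine ⟨⟨m, R, [⟨0, fun _ => b, K⟩], by simp, Q⟩, fun c hc x => ?_⟩
  set N : NeuralOperator n := ⟨m, R, [⟨0, fun _ => b, K⟩], by simp, Q⟩ with hN
  set v : C(X, Fin m → ℝ) := N.liftLayer σ c with hv
  set u : Fin m → ℝ := (HiddenLayer.mk 0 (fun _ => b) K).nonlocal σ v x with hu
  set u₀ : Fin m → ℝ := fun i => moment (φ i) c with hu₀
  have hnear : ∀ i, |u i - u₀ i| < min ρ 1 := fun i => hRK c v hc (fun _ => rfl) x i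
  have hu₀box : u₀ ∈ box := fun i _ => by
    have := abs_le.1 (hM c hc i)
    exact ⟨by linarith [this.1], by linarith [this.2]⟩
  have hubox : u ∈ box := fun i _ => by
    have h1 := abs_le.1 (hM c hc i)
    have h2 := abs_lt.1 ((hnear i).trans_le (min_le_right _ _))
    simp only [hu₀] at h2
    exact ⟨by linarith [h1.1, h2.1], by linarith [h1.2, h2.2]⟩
  have hdist : dist u u₀ < ρ := (dist_pi_lt_iff hρ).2 fun i => by
    rw [Real.dist_eq]; exact (hnear i).trans_le (min_le_left _ _)
  have heval : N.eval σ c x = Q.eval σ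
      (Fin.append (act u) (fun a => (x : EuclideanSpace ℝ (Fin n)) a)) 0 := by
    have hlayer : (HiddenLayer.mk 0 (fun _ => b) K).apply σ v x = act u := by
      ext i
      simp [HiddenLayer.apply, act, hu]
    rw [← hlayer]
    rfl
  have h1 := hQ _ ⟨(u, (x : EuclideanSpace ℝ (Fin n))), ⟨hubox, x.2⟩, rfl⟩ 0
  simp only [ContinuousMap.coe_mk, Fin.append_left, Fin.append_right, WithLp.toLp_ofLp] at h1
  have h2 := hρP (u, (x : EuclideanSpace ℝ (Fin n))) ⟨hubox, x.2⟩ (u₀, x) ⟨hu₀box, x.2⟩ (by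
    rw [Prod.dist_eq, dist_self]; exact max_lt hdist hρ)
  rw [Real.dist_eq] at h2
  rw [heval]
  calc _ = |(Q.eval σ (Fin.append (act u) (fun a => (x : EuclideanSpace ℝ (Fin n)) a)) 0
        - P (act u, x)) + (P (act u, x) - P (act u₀, x))| := by rw [sub_add_sub_cancel]
    _ ≤ _ := abs_add_le _ _
    _ < δ := by linarith

/-- Universal approximation by neural operators: every continuous function of `(c, x)` is
approximated uniformly on compact sets of inputs `c`. -/
lemma exists_neuralOperator_near_of_isCompact
    (hσ : ContDiff ℝ 2 σ) (h : ¬ ∃ a b : ℝ, ∀ t, σ t = a * t + b)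
    [(compactsVolume X).IsOpenPosMeasure]
    (f : C(C(X, ℝ) × X, ℝ)) {K : Set C(X, ℝ)} (hK : IsCompact K) {δ : ℝ} (hδ : 0 < δ) :
    ∃ N : NeuralOperator n, ∀ c ∈ K, ∀ x : X, |N.eval σ c x - f (c, x)| < δ := by
  obtain ⟨b, hb⟩ := exists_deriv_ne_zero (hσ.differentiable two_ne_zero) h
  obtain ⟨g, ⟨m, φ, P, hg⟩, hgf⟩ :=
    ContinuousMap.exists_mem_subalgebra_near_continuous_of_isCompact_of_separatesPoints
      (separatesPoints_nonlocalAlgebra (X := X) hb) f (hK.prod isCompact_univ) (half_pos hδ)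
  obtain ⟨θ, hθ, hKθ⟩ := hK.isBounded.exists_pos_norm_le
  obtain ⟨N, hN⟩ := exists_neuralOperator_near (X := X) hσ h φ b P hθ.le (half_pos hδ)
  refine ⟨N, fun c hc x => ?_⟩
  have h1 := hN c (fun x => (c.norm_coe_le_norm x).trans (hKθ c hc)) x
  have h2 := hgf (c, x) ⟨hc, trivial⟩
  rw [← hg, abs_lt] at h1
  rw [Real.norm_eq_abs, abs_lt] at h2
  exact abs_lt.2 ⟨by linarith [h1.1, h2.1], by linarith [h1.2, h2.2]⟩

end

/-! ### Continuous extension of uniformly continuous operators -/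

/-- An operator with a modulus of continuity on a totally bounded set is approximated by a
continuous function on the whole space. -/
lemma exists_continuousMap_near_of_totallyBounded {α β : Type*} [PseudoMetricSpace α]
    [TopologicalSpace β] {F : Set α} (hF : TotallyBounded F) (Ψ : F → C(β, ℝ)) {S : Set β}
    {δ ε : ℝ} (hδ : 0 < δ)
    (hΨ : ∀ c c' : F, dist (c : α) c' < δ → ∀ x ∈ S, |Ψ c x - Ψ c' x| ≤ ε) :
    ∃ f : C(α × β, ℝ), ∀ c : F, ∀ x ∈ S, |Ψ c x - f (c, x)| ≤ ε := by
  obtain ⟨T, hT⟩ : ∃ T : Finset F, ∀ c : F, ∃ y ∈ T, dist (c : α) y < δ / 2 := by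
    obtain ⟨t, htF, htfin, ht⟩ := Metric.finite_approx_of_totallyBounded hF _ (half_pos hδ)
    refine ⟨(htfin.preimage Subtype.val_injective.injOn).toFinset, fun c => ?_⟩
    obtain ⟨y, hy, hcy⟩ := Set.mem_iUnion₂.1 (ht c.2)
    exact ⟨⟨y, htF hy⟩, by simpa using hy, hcy⟩
  -- Tent weights: only net points within `δ` of `c` contribute to the average. The floor `δ / 2` in
  -- the denominator keeps it continuous everywhere and is inactive on `F`, since the net is `δ /
  -- 2`-dense there.
  let w : F → α → ℝ := fun y c => max 0 (δ - dist c y)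
  have hw : ∀ y, Continuous (w y) := fun y => by fun_prop
  have hw0 : ∀ y c, 0 ≤ w y c := fun y c => le_max_left _ _
  refine ⟨⟨fun p => (∑ y ∈ T, w y p.1 * Ψ y p.2) / max (∑ y ∈ T, w y p.1) (δ / 2), ?_⟩, ?_⟩
  · refine Continuous.div ?_ ?_ fun p => (lt_max_of_lt_right (half_pos hδ)).ne'
    · exact continuous_finsetSum _ fun y _ => by fun_prop
    · exact (continuous_finsetSum _ fun y _ => by fun_prop).max continuous_const
  intro c x hx
  set W := ∑ y ∈ T, w y c with hW
  have hWδ : δ / 2 ≤ W := by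
    obtain ⟨y, hy, hcy⟩ := hT c
    calc δ / 2 ≤ w y c := le_max_of_le_right (by linarith)
      _ ≤ W := Finset.single_le_sum (f := fun y => w y c) (fun y _ => hw0 y c) hy
  have hW0 : 0 < W := (half_pos hδ).trans_le hWδ
  have hterm : ∀ y ∈ T, |w y c * (Ψ c x - Ψ y x)| ≤ w y c * ε := fun y _ => by
    rw [abs_mul, abs_of_nonneg (hw0 y c)]
    rcases (hw0 y c).eq_or_lt with h0 | h0
    · simp [← h0]
    · have hlt : dist (c : α) y < δ := by
        rcases lt_max_iff.1 h0 with h1 | h1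
        · exact absurd h1 (lt_irrefl _)
        · linarith
      exact mul_le_mul_of_nonneg_left (hΨ c y hlt x hx) h0.le
  simp only [ContinuousMap.coe_mk, ← hW, max_eq_left hWδ]
  have heq : Ψ c x - (∑ y ∈ T, w y c * Ψ y x) / W = (∑ y ∈ T, w y c * (Ψ c x - Ψ y x)) / W := by
    simp only [mul_sub, Finset.sum_sub_distrib, ← Finset.sum_mul, ← hW]
    field_simp
  rw [heq, abs_div, abs_of_pos hW0, div_le_iff₀ hW0]
  calc _ ≤ ∑ y ∈ T, |w y c * (Ψ c x - Ψ y x)| := Finset.abs_sum_le_sum_abs _ _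
    _ ≤ ∑ y ∈ T, w y c * ε := Finset.sum_le_sum hterm
    _ = ε * W := by rw [← Finset.sum_mul, mul_comm]

/-- Arzelà–Ascoli for bounded equicontinuous families on a compact space. -/
lemma isCompact_closure_of_equicontinuous {X : Type*} [TopologicalSpace X] [CompactSpace X]
    {F : Set C(X, ℝ)} {θ : ℝ} (hF : Equicontinuous fun (c : F) (x : X) => (c : C(X, ℝ)) x)
    (hθ : ∀ c ∈ F, ∀ x, |c x| ≤ θ) : IsCompact (closure F) := by
  let e := ContinuousMap.isometryEquivBoundedOfCompact X ℝ
  have h := BoundedContinuousFunction.arzela_ascoli (Metric.closedBall (0 : ℝ) θ)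
    (isCompact_closedBall _ _) (e '' F) (by
      rintro _ x ⟨c, hc, rfl⟩
      rw [mem_closedBall_zero_iff]
      exact hθ c hc x) (by
      choose u hu hue using fun a : e '' F => a.2
      have h1 : ((↑) : e '' F → X → ℝ) =
          (fun (c : F) (x : X) => (c : C(X, ℝ)) x) ∘ fun a => ⟨u a, hu a⟩ := by
        ext a x
        show a.1 x = (e.symm (e (u a))) x
        rw [hue a]
        rfl
      exact h1 ▸ hF.comp _)
  have h1 : e '' closure F = closure (e '' F) := e.toHomeomorph.image_closure F
  rw [← h1] at h
  exact e.toHomeomorph.isCompact_image.1 h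

/-! ### The main theorem -/

/-- The solution operator of the Eikonal problem is uniformly continuous on bounded families of
costs. -/
lemma exists_modulus_of_isViscositySolution {n : ℕ} {X : Compacts (EuclideanSpace ℝ (Fin n))}
    {S G : Set (EuclideanSpace ℝ (Fin n))} (hSX : S ⊆ X) (hGS : G ⊆ S) (hS : IsClosed S)
    (hS_lip : ∀ p ∈ frontier S \ closure G, HasLipschitzBoundaryAt S p)
    {F : Set C(X, ℝ)} {θ : ℝ} (hθ : 0 < θ) (hF : ∀ c ∈ F, ∀ x : X, 1 / θ < c x ∧ c x < θ)
    {Ψ : F → C(X, ℝ)} (hΨ : ∀ c : F, IsViscositySolution S G (c : C(X, ℝ)) (Ψ c))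
    {ε : ℝ} (hε : 0 < ε) :
    ∃ δ : ℝ, 0 < δ ∧ ∀ c c' : F, dist (c : C(X, ℝ)) c' < δ →
      ∀ x ∈ {x : X | (x : EuclideanSpace ℝ (Fin n)) ∈ S}, |Ψ c x - Ψ c' x| ≤ ε := by
  rcases isEmpty_or_nonempty F with hempty | ⟨⟨c₀⟩⟩
  · exact ⟨1, one_pos, fun c => hempty.elim c⟩
  have hcθ : ∀ (c : F) (x : X), 1 < θ * (c : C(X, ℝ)) x := fun c x => by
    rw [mul_comm]
    exact (div_lt_iff₀ hθ).1 (hF c c.2 x).1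
  -- From `c < θ` and `c₀ > 1 / θ` follows `c < θ ^ 2 c₀`, so comparison with one fixed cost bounds
  -- all solutions from above.
  set B : ℝ := θ ^ 2 * ‖Ψ c₀‖ with hB
  have hB0 : 0 ≤ B := by positivity
  have hbound : ∀ (c : F) (x : X), (x : EuclideanSpace ℝ (Fin n)) ∈ S → Ψ c x ≤ B := by
    intro c x hx
    refine ((hΨ c₀).le_mul_of_lt_mul hSX hGS hS hS_lip (hΨ c) (pow_pos hθ 2) (fun y => ?_)
      x hx).trans ?_
    · have h1 := (hF c c.2 y).2
      nlinarith [hcθ c₀ y]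
    · have h1 := (le_abs_self _).trans ((Ψ c₀).norm_coe_le_norm x)
      exact mul_le_mul_of_nonneg_left h1 (by positivity)
  refine ⟨ε / (θ * (B + 1)), by positivity, ?_⟩
  have hone : ∀ c c' : F, dist (c : C(X, ℝ)) c' < ε / (θ * (B + 1)) →
      ∀ x : X, (x : EuclideanSpace ℝ (Fin n)) ∈ S → Ψ c' x ≤ Ψ c x + ε := by
    intro c c' hcc' x hx
    set δ := ε / (θ * (B + 1)) with hδ
    have hδ0 : 0 < δ := by positivity
    -- Because `1 < θ c`, an additive change below `δ` is multiplicative: `c' < c + δ < (1 + δ θ)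
    -- c`.
    have h1 := (hΨ c).le_mul_of_lt_mul hSX hGS hS hS_lip (hΨ c') (μ := 1 + δ * θ) (by positivity)
      (fun y => by
        have h2 := (ContinuousMap.dist_apply_le_dist (f := (c : C(X, ℝ))) (g := c') y).trans_lt hcc'
        rw [Real.dist_eq, abs_lt] at h2
        nlinarith [hcθ c y, h2.1]) x hx
    have h2 : δ * θ * Ψ c x ≤ δ * θ * (B + 1) := by
      have := hbound c x hx
      gcongr
      linarith
    have h3 : δ * θ * (B + 1) = ε := by rw [hδ]; field_simp
    linarith
  intro c c' hcc' x hx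
  have h1 := hone c c' hcc' x hx
  have h2 := hone c' c (by rwa [dist_comm]) x hx
  exact abs_le.2 ⟨by linarith, by linarith⟩

theorem theorem1 {n : ℕ}
    -- the activation function: smooth and not affine
    (σ : C(ℝ, ℝ)) (hσ : ContDiff ℝ ∞ σ) (hσ_affine : ¬ ∃ a b : ℝ, ∀ t, σ t = a * t + b)
    -- the state space, the safe set and the goal set
    (X : Compacts (EuclideanSpace ℝ (Fin n)))
    (hX : ∀ p ∈ frontier (X : Set (EuclideanSpace ℝ (Fin n))),
      HasLipschitzBoundaryAt (X : Set (EuclideanSpace ℝ (Fin n))) p)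
    (S G : Set (EuclideanSpace ℝ (Fin n)))
    (hSX : S ⊆ (X : Set (EuclideanSpace ℝ (Fin n)))) (hGS : G ⊆ S) (hS : IsClosed S)
    (hS_lip : ∀ p ∈ frontier S \ closure G, HasLipschitzBoundaryAt S p)
    (hproper : HasProperPolicy X S G)
    -- the space of costs
    (F : Set C(X, ℝ)) (hF_equi : UniformEquicontinuous fun (c : F) (x : X) => (c : C(X, ℝ)) x)
    (θ : ℝ) (hθ : 0 < θ) (hF_bdd : ∀ c ∈ F, ∀ x : X, 1 / θ < c x ∧ c x < θ)
    -- the solution operator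
    (Ψ : F → C(X, ℝ)) (hΨ : ∀ c : F, IsViscositySolution S G (c : C(X, ℝ)) (Ψ c))
    (ε : ℝ) (hε : 0 < ε) :
    ∃ N : NeuralOperator n, ∀ c : F, ∀ x : X, (x : EuclideanSpace ℝ (Fin n)) ∈ S →
      |Ψ c x - N.eval σ (c : C(X, ℝ)) x| ≤ ε := by
  have hσ₂ : ContDiff ℝ 2 σ := contDiff_infty.1 hσ 2
  have hpos := isOpenPosMeasure_compactsVolume X hX
  have hθF : ∀ c ∈ F, ∀ x : X, |c x| ≤ θ := fun c hc x => by
    have h1 := hF_bdd c hc x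
    have h2 : 0 < 1 / θ := by positivity
    exact abs_le.2 ⟨by linarith [h1.1], h1.2.le⟩
  have hK := isCompact_closure_of_equicontinuous hF_equi.equicontinuous hθF
  obtain ⟨δ, hδ, hΨδ⟩ :=
    exists_modulus_of_isViscositySolution hSX hGS hS hS_lip hθ hF_bdd hΨ (half_pos hε)
  obtain ⟨f, hf⟩ := exists_continuousMap_near_of_totallyBounded
    (hK.totallyBounded.subset subset_closure) Ψ hδ hΨδ
  obtain ⟨N, hN⟩ :=
    exists_neuralOperator_near_of_isCompact hσ₂ hσ_affine f hK (half_pos hε)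
  refine ⟨N, fun c x hx => ?_⟩
  have h1 := abs_le.1 (hf c x hx)
  have h2 := abs_lt.1 (hN c (subset_closure c.2) x)
  exact abs_le.2 ⟨by linarith [h1.1, h2.2], by linarith [h1.2, h2.1]⟩
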